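/- **Setting.** Constants, labelled nulls and variables form three disjoint countably infinite sets. A *tuple-generating dependency* (TGD, rule) $\sigma$ is a formula $\Phi(\mathbf x,\mathbf y)\to\exists\mathbf z\,\Psi(\mathbf x,\mathbf z)$, where the body $\Phi$ and the head $\Psi$ are finite conjunctions of atoms over variables and constants; $\mathbf x$ are its frontier variables, $\mathbf z$ its existential variables. An *ontology* $\Sigma$ is a finite set of TGDs, renamed apart; a *class* of TGDs is an arbitrary set $\mathcal C$ of ontologies. An *instance* is a possibly infinite set of atoms over constants and nulls; a *database* is a finite set of atoms over constants. For a conjunctive query $q(\mathbf x)$, all of whose output variables occur in its atoms, $\mathrm{cert}(q,D,\Sigma)$ is the set of the constant tuples that are answers to $q$ in every instance $I\supseteq D$ that satisfies $\Sigma$. The problem *cert-eval*$[\mathcal C]$ has as inputs a database $D$, an ontology $\Sigma\in\mathcal C$, a conjunctive query $q(\mathbf x)$ and a constant tuple $\mathbf c$ of length $|\mathbf x|$, and asks whether $\mathbf c\in\mathrm{cert}(q,D,\Sigma)$. It is *decidable* if some algorithm halts with the correct answer on every such input (nothing is required when $\Sigma\notin\mathcal C$, so membership in $\mathcal C$ need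 not be decidable). It is *decidable as a set* if the set of its yes-instances $(D,\Sigma,q,\mathbf c)$ (with $\Sigma \in \mathcal C$) is a decidable set. **Affected positions.** Let $z$ be an existential variable of $\Sigma$. The $z$-affected positions are the least set of predicate positions that contains every position at which $z$ occurs in a head, and every position at which a frontier variable $x$ of a rule of $\Sigma$ occurs in the head, provided that $x$ occurs in the body of that rule at $z$-affected positions only. A variable of the body of $\sigma\in\Sigma$ is *harmful* if for some $z$ all its positions in the body are $z$-affected, and *harmless* otherwise; it is *dangerous* if it is harmful and a frontier variable. The set $p(\sigma)$ of the *problematic* atoms is the least set of body atoms of $\sigma$ that contains each body atom with a dangerous variable and each body atom that shares a harmful variable with an atom of $p(\sigma)$; $s(\sigma)$ is the set of the other body atoms. **The class Dyadic-$\mathcal C$.** Let $\mathrm{br}(\sigma)$ consist of the variables that occur both in $p(\sigma)$ and in $s(\sigma)$ and of the harmless frontier variables that occur in $s(\sigma)$. Let $\mathrm{main}(\sigma)$ be the rule $$\mathrm{Aux}_\sigma(\mathrm{br}(\sigma)),\ p(\sigma)\ \to\ \exists\,\mathbf z\ \mathrm{head}(\sigma)$$ with a predicate $\mathrm{Aux}_\sigma$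 that is new, one for each rule and chosen by a fixed computable convention. If a variable of $\mathrm{br}(\sigma)$ occurs $n>1$ times in $\mathrm{head}(\sigma)$, then its occurrences there receive $n$ different names (the first one being kept, the others new), all of which are arguments of $\mathrm{Aux}_\sigma$. Let $\mathrm{main}(\Sigma)=\{\mathrm{main}(\sigma):\sigma\in\Sigma\}$, and let Dyadic-$\mathcal C$ be the set of all ontologies $\Sigma$ with $\Sigma\in\mathcal C$ or $\mathrm{main}(\Sigma)\in\mathcal C$. **Theorem.** Let $\mathcal C$ be a class of TGDs. 1. Suppose that cert-eval$[\mathcal C]$ is decidable. Then cert-eval$[\{\Sigma:\mathrm{main}(\Sigma)\in\mathcal C\}]$ is decidable. Moreover, if there is an algorithm that, for each $\Sigma\in$ Dyadic-$\mathcal C$, finds one of the two conditions $\Sigma\in\mathcal C$ and $\mathrm{main}(\Sigma)\in\mathcal C$ that is true (for instance if membership in $\mathcal C$ is decidable, or if $\Sigma\in\mathcal C$ always implies $\mathrm{main}(\Sigma)\in\mathcal C$), then cert-eval$[$Dyadic-$\mathcal C]$ is decidable. 2. If cert-eval$[\mathcal C]$ is decidable as a set, then so is cert-eval$[$Dyadic-$\mathcal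 C]$. -/

import Mathlib

namespace DyadicTGD

/-! ### Syntax -/

/-- Terms of rules and queries: constants (`Sum.inl c`) and variables (`Sum.inr x`). -/
abbrev Term := ℕ ⊕ ℕ

abbrev Term.const (c : ℕ) : Term := Sum.inl c

abbrev Term.var (x : ℕ) : Term := Sum.inr x

/-- Values of instances: constants (`Sum.inl c`) and labelled nulls (`Sum.inr n`). -/
abbrev Value := ℕ ⊕ ℕ

abbrev Value.const (c : ℕ) : Value := Sum.inl c

abbrev Value.null (n : ℕ) : Value := Sum.inr n

/-- Atoms `P(t₁, …, tₖ)` with arguments in `α`: the name of `P` and the tuple of arguments.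
A predicate is a name together with an arity, so that atoms with equal names and a different
number of arguments belong to different predicates. -/
abbrev AtomOver (α : Type) := ℕ × List α

abbrev Atom := AtomOver Term

/-- A fact is an atom that contains only constants. -/
abbrev Fact := AtomOver ℕ

/-- A conjunction of atoms. -/
abbrev Conj := List Atom

/-- A tuple-generating dependency, as the pair (body, head). The existential variables are the
variables of the head that do not occur in the body. -/
abbrev Rule := Conj × Conj

/-- An ontology: a finite set of rules, given as a list. -/
abbrev Ontology := List Rule

/-- A database: a finite set of facts, given as a list. -/
abbrev Database := List Fact

/-- A conjunctive query, as the pair (tuple of output variables, conjunction of atoms); the other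
variables of the conjunction are existentially quantified. -/
abbrev CQ := List ℕ × Conj

/-- The variables of a tuple of terms. -/
def termVars (ts : List Term) : List ℕ := ts.filterMap Sum.getRight?

/-- The variables of a conjunction of atoms. -/
def conjVars (A : Conj) : List ℕ := A.flatMap fun a => termVars a.2

/-- Every output variable occurs in the conjunction. -/
def CQ.WellFormed (q : CQ) : Prop := ∀ x ∈ q.1, x ∈ conjVars q.2

/-! ### Semantics -/

/-- Instances: possibly infinite sets of atoms over constants and nulls. -/
abbrev Instance := Set (AtomOver Value)

/-- The image of a term under an assignment of the variables; constants are fixed. -/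
def valueOf (h : ℕ → Value) : Term → Value := Sum.elim Value.const h

/-- `h` is a homomorphism from the conjunction `A` to `I`. -/
def IsHom (h : ℕ → Value) (A : Conj) (I : Instance) : Prop :=
  ∀ a ∈ A, (a.1, a.2.map (valueOf h)) ∈ I

/-- The frontier variables: those that occur both in the body and in the head. -/
def IsFrontier (σ : Rule) (x : ℕ) : Prop := x ∈ conjVars σ.1 ∧ x ∈ conjVars σ.2

/-- The existential variables: those that occur in the head but not in the body. -/
def IsExVar (σ : Rule) (z : ℕ) : Prop := z ∈ conjVars σ.2 ∧ z ∉ conjVars σ.1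

def SatRule (I : Instance) (σ : Rule) : Prop :=
  ∀ h, IsHom h σ.1 I → ∃ h', (∀ x, IsFrontier σ x → h' x = h x) ∧ IsHom h' σ.2 I

/-- `I` is a model of the database `D` and the ontology `S`. -/
def IsModel (D : Database) (S : Ontology) (I : Instance) : Prop :=
  (∀ a ∈ D, (a.1, a.2.map Value.const) ∈ I) ∧ ∀ σ ∈ S, SatRule I σ

/-- The evaluation of a query over an instance: a set of tuples of constants. -/
def evalCQ (q : CQ) (I : Instance) : Set (List ℕ) :=
  {c | ∃ h, IsHom h q.2 I ∧ q.1.map h = c.map Value.const}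

/-- The certain answers. -/
def cert (q : CQ) (D : Database) (S : Ontology) : Set (List ℕ) :=
  {c | ∀ I, IsModel D S I → c ∈ evalCQ q I}

/-! ### Affected positions and classification of variables -/

/-- The position `P[i]` of the predicate with the given name and arity (`i` counted from `0`). -/
structure Position where
  name : ℕ
  arity : ℕ
  index : ℕ

/-- The variable `x` occurs in the conjunction `A` at position `π`. -/
def OccursAt (x : ℕ) (A : Conj) (π : Position) : Prop :=
  ∃ a ∈ A, a.1 = π.name ∧ a.2.length = π.arity ∧ a.2[π.index]? = some (Term.var x)

/-- `Affected S ρ z π`: the position `π` is `z`-affected, where `z` is an existential variable of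
the rule `ρ ∈ S`. Existential variables are identified by their rule and their name, so that
rules need not be renamed apart. -/
inductive Affected (S : Ontology) (ρ : Rule) (z : ℕ) : Position → Prop
  | intro {π : Position} (hρ : ρ ∈ S) (hz : IsExVar ρ z) (hπ : OccursAt z ρ.2 π) :
      Affected S ρ z π
  | propagate {π : Position} (σ : Rule) (x : ℕ) (hσ : σ ∈ S) (hx : IsFrontier σ x)
      (hπ : OccursAt x σ.2 π) (hb : ∀ π', OccursAt x σ.1 π' → Affected S ρ z π') :
      Affected S ρ z π

/-- The set of the existential variables that affect `π`. -/
def aff (S : Ontology) (π : Position) : Set (Rule × ℕ) := {e | Affected S e.1 e.2 π}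

/-- The existential variables that affect all the positions of the body of `σ` at which `x`
occurs. -/
def commonAff (S : Ontology) (σ : Rule) (x : ℕ) : Set (Rule × ℕ) :=
  {e | ∀ π, OccursAt x σ.1 π → e ∈ aff S π}

def Harmless (S : Ontology) (σ : Rule) (x : ℕ) : Prop :=
  x ∈ conjVars σ.1 ∧ commonAff S σ x = ∅

def Harmful (S : Ontology) (σ : Rule) (x : ℕ) : Prop :=
  x ∈ conjVars σ.1 ∧ commonAff S σ x ≠ ∅

def Dangerous (S : Ontology) (σ : Rule) (x : ℕ) : Prop :=
  Harmful S σ x ∧ IsFrontier σ x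

/-- The problematic atoms of the body of `σ`. -/
inductive Problematic (S : Ontology) (σ : Rule) : Atom → Prop
  | dangerous (a : Atom) (x : ℕ) (ha : a ∈ σ.1) (hx : x ∈ termVars a.2)
      (hd : Dangerous S σ x) : Problematic S σ a
  | connected (a b : Atom) (x : ℕ) (ha : a ∈ σ.1) (hb : Problematic S σ b)
      (hxa : x ∈ termVars a.2) (hxb : x ∈ termVars b.2) (hx : Harmful S σ x) :
      Problematic S σ a

/-! ### The main part of an ontology -/

open Classical in
noncomputable def pAtoms (S : Ontology) (σ : Rule) : Conj :=
  σ.1.filter fun a => Problematic S σ a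

open Classical in
noncomputable def sAtoms (S : Ontology) (σ : Rule) : Conj :=
  σ.1.filter fun a => ¬ Problematic S σ a

open Classical in
/-- The variables shared by problematic and safe atoms, and the harmless frontier variables of the
safe atoms; each of them is listed once. -/
noncomputable def bridge (S : Ontology) (σ : Rule) : List ℕ :=
  (conjVars (sAtoms S σ)).dedup.filter fun x =>
    x ∈ conjVars (pAtoms S σ) ∨ (Harmless S σ x ∧ IsFrontier σ x)

/-- A predicate name larger than all those of `S`. -/
def freshName (S : Ontology) : ℕ :=
  ((S.flatMap fun σ => (σ.1 ++ σ.2).map Prod.fst).foldr max 0) + 1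

/-- A variable larger than all those of `S`. -/
def freshVar (S : Ontology) : ℕ :=
  ((S.flatMap fun σ => conjVars (σ.1 ++ σ.2)).foldr max 0) + 1

/-- The head `H` with every argument `t` replaced by a pair `(t, t')`. If `t` is a variable of `B`
which occurs earlier in `H`, then `t'` is a new variable, a separate one for every such occurrence;
otherwise `t' = t`. -/
def splitHead (B : List ℕ) (new : ℕ → ℕ → ℕ) (H : Conj) : List (AtomOver (Term × Term)) :=
  H.mapIdx fun i a => (a.1, a.2.mapIdx fun j t =>
    match t with
    | Sum.inl c => (Term.const c, Term.const c)
    | Sum.inr x =>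
      if x ∈ B ∧ (x ∈ conjVars (H.take i) ∨ x ∈ termVars (a.2.take j))
      then (Term.var x, Term.var (new i j)) else (Term.var x, Term.var x))

/-- The rule `Aux_σ(bridge(σ)), p-atoms(σ) → ∃ exvars(σ) head(σ)` of the `k`-th rule `σ` of `S`,
with the fresh predicate `Aux_σ`. If a bridge variable occurs `n > 1` times in the head of `σ`, then
it is given `n` different names in the head, all of which are arguments of `Aux_σ`. -/
noncomputable def mainRule (S : Ontology) (k : ℕ) (σ : Rule) : Rule :=
  let B := bridge S σ
  let H := splitHead B (fun i j => freshVar S + Nat.pair k (Nat.pair i j)) σ.2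
  let copies := ((H.flatMap Prod.snd).filter fun p => p.1 ≠ p.2).map Prod.snd
  ((freshName S + k, B.map Term.var ++ copies) :: pAtoms S σ,
    H.map fun a => (a.1, a.2.map Prod.snd))

noncomputable def mainPart (S : Ontology) : Ontology := S.mapIdx (mainRule S)

/-- The class Dyadic-`C`. -/
def Dyadic (C : Set Ontology) : Set Ontology := {S | S ∈ C ∨ mainPart S ∈ C}

/-! ### The problem cert-eval -/

abbrev Input := Database × Ontology × CQ × List ℕ

/-- `(D, S, q, c)` is an input of cert-eval[`C`]. -/
def IsInput (C : Set Ontology) : Input → Prop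
  | (_, S, q, c) => S ∈ C ∧ q.WellFormed ∧ c.length = q.1.length

/-- The question of cert-eval: is `c` a certain answer? -/
def Holds : Input → Prop
  | (D, S, q, c) => c ∈ cert q D S

/-- cert-eval[`C`] is decidable: some algorithm halts with the correct answer on every input of the
problem. Nothing is required where the ontology is not in `C`, so that `C` itself need not be
recognizable. -/
def CertEvalDecidable (C : Set Ontology) : Prop :=
  ∃ f : Input →. Bool, Partrec f ∧
    ∀ w, IsInput C w → ∃ b ∈ f w, (b = true ↔ Holds w)

/-- The set of the yes-instances of cert-eval[`C`] is a decidable set; this algorithm also has to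
reject what is not an input of the problem. -/
def CertEvalDecidableSet (C : Set Ontology) : Prop :=
  ComputablePred fun w => IsInput C w ∧ Holds w

/-- Some algorithm finds, for every ontology in Dyadic-`C`, one of the two conditions `S ∈ C` and
`mainPart S ∈ C` that holds. -/
def CaseEffective (C : Set Ontology) : Prop :=
  ∃ s : Ontology →. Bool, Partrec s ∧
    ∀ S ∈ Dyadic C, ∃ b ∈ s S, (b = true → S ∈ C) ∧ (b = false → mainPart S ∈ C)

end DyadicTGD

/-!
A null introduced by an existential variable `z` occurs in the chase only at the `z`-affected
positions. The variables of `br(σ)` are harmless, so every match of the body of `σ` in the chase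
sends them to constants, and the facts over `Aux_σ` form a finite set: the certain answers to
`s(σ)`, read as a query for `br(σ)`. With all these facts in the database, `main(Σ)` has the same
certain answers as `Σ`. A model of `Σ` becomes a model of `main(Σ)` by adding all answers to `s(σ)`
as facts over `Aux_σ`, and the chase of `main(Σ)`, without these facts, is a model of `Σ`.

The auxiliary facts are found by iteration, since each of them is a certain answer over `main(Σ)`
and the facts found before: a list to which no step adds a new fact is complete. Finding such a list
and then answering the query only involves cert-eval for `main(Σ)`. The decision procedure for
cert-eval is partial, so the search is for a list together with a number of computation steps that
suffices to confirm it. In the same way `main(Σ)` is computable, as the affected positions and the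
problematic atoms are found by searching for lists that are derivable and closed.
-/

namespace DyadicTGD

/-! ### Variables, terms and homomorphisms -/

theorem mem_termVars {x : ℕ} {ts : List Term} : x ∈ termVars ts ↔ Term.var x ∈ ts := by
  simp [termVars, List.mem_filterMap, Sum.getRight?_eq_some_iff]

theorem mem_conjVars {x : ℕ} {A : Conj} : x ∈ conjVars A ↔ ∃ a ∈ A, Term.var x ∈ a.2 := by
  simp only [conjVars, List.mem_flatMap, mem_termVars]

theorem conjVars_subset {A B : Conj} (h : A ⊆ B) : conjVars A ⊆ conjVars B := fun _ hx =>
  let ⟨a, ha, hxa⟩ := mem_conjVars.1 hx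
  mem_conjVars.2 ⟨a, h ha, hxa⟩

theorem mem_conjVars_iff_occursAt {x : ℕ} {A : Conj} : x ∈ conjVars A ↔ ∃ π, OccursAt x A π := by
  rw [mem_conjVars]
  constructor
  · rintro ⟨a, ha, hx⟩
    obtain ⟨i, hi⟩ := List.getElem?_of_mem hx
    exact ⟨⟨a.1, a.2.length, i⟩, a, ha, rfl, rfl, hi⟩
  · rintro ⟨π, a, ha, -, -, h⟩
    exact ⟨a, ha, List.mem_of_getElem? h⟩

@[simp] theorem valueOf_var (h : ℕ → Value) (x : ℕ) : valueOf h (Sum.inr x) = h x := rfl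

theorem map_valueOf_congr {h h' : ℕ → Value} {ts : List Term}
    (H : ∀ x, Term.var x ∈ ts → h x = h' x) : ts.map (valueOf h) = ts.map (valueOf h') := by
  refine List.map_congr_left fun t ht => ?_
  rcases t with c | x
  · rfl
  · exact H x ht

theorem map_map_valueOf {φ : Value → Value} (hφ : ∀ c, φ (Value.const c) = Value.const c)
    (h : ℕ → Value) (ts : List Term) :
    (ts.map (valueOf h)).map φ = ts.map (valueOf (φ ∘ h)) := by
  rw [List.map_map]
  refine List.map_congr_left fun t _ => ?_
  rcases t with c | x
  · exact hφ c
  · rfl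

theorem isHom_congr {h h' : ℕ → Value} {A : Conj} {I : Instance}
    (H : ∀ x ∈ conjVars A, h x = h' x) : IsHom h A I ↔ IsHom h' A I := by
  refine forall₂_congr fun a ha => ?_
  rw [map_valueOf_congr fun x hx => H x (mem_conjVars.2 ⟨a, ha, hx⟩)]

/-- The conjunction `A` with its variables renamed by `o`. -/
def renameVars (o : ℕ → ℕ) (A : Conj) : Conj := A.map fun a => (a.1, a.2.map (Sum.map id o))

theorem valueOf_comp (h : ℕ → Value) (o : ℕ → ℕ) :
    valueOf (h ∘ o) = valueOf h ∘ Sum.map id o := by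
  funext t
  rcases t with c | x <;> rfl

theorem isHom_renameVars {h : ℕ → Value} {o : ℕ → ℕ} {A : Conj} {I : Instance} :
    IsHom h (renameVars o A) I ↔ IsHom (h ∘ o) A I := by
  simp only [IsHom, renameVars, List.forall_mem_map, List.map_map, valueOf_comp]

theorem mem_conjVars_renameVars {o : ℕ → ℕ} {A : Conj} {x : ℕ} (hx : x ∈ conjVars A) :
    o x ∈ conjVars (renameVars o A) := by
  obtain ⟨a, ha, hxa⟩ := mem_conjVars.1 hx
  exact mem_conjVars.2 ⟨_, List.mem_map_of_mem ha, List.mem_map_of_mem (f := Sum.map id o) hxa⟩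

/-! ### Fresh names -/

theorem name_lt_freshName {S : Ontology} {σ : Rule} (hσ : σ ∈ S) {a : Atom}
    (ha : a ∈ σ.1 ∨ a ∈ σ.2) : a.1 < freshName S :=
  Nat.lt_succ_of_le <| List.le_max_of_le
    (List.mem_flatMap.2 ⟨σ, hσ, List.mem_map_of_mem (List.mem_append.2 ha)⟩) le_rfl

theorem var_lt_freshVar {S : Ontology} {σ : Rule} (hσ : σ ∈ S) {x : ℕ}
    (hx : x ∈ conjVars σ.1 ∨ x ∈ conjVars σ.2) : x < freshVar S := by
  refine Nat.lt_succ_of_le (List.le_max_of_le (List.mem_flatMap.2 ⟨σ, hσ, ?_⟩) le_rfl)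
  exact hx.elim (fun h => conjVars_subset (List.subset_append_left _ _) h)
    fun h => conjVars_subset (List.subset_append_right _ _) h

theorem Affected.name_lt_freshName {S : Ontology} {ρ : Rule} {z : ℕ} {π : Position}
    (h : Affected S ρ z π) : π.name < freshName S := by
  rcases h with ⟨hρ, -, a, ha, hname, -⟩ | ⟨σ, x, hσ, -, ⟨a, ha, hname, -⟩, -⟩
  · exact hname ▸ DyadicTGD.name_lt_freshName hρ (Or.inr ha)
  · exact hname ▸ DyadicTGD.name_lt_freshName hσ (Or.inr ha)

/-! ### Problematic and safe atoms -/

section Split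

variable {S : Ontology} {σ : Rule}

theorem mem_pAtoms {a : Atom} : a ∈ pAtoms S σ ↔ a ∈ σ.1 ∧ Problematic S σ a := by
  simp [pAtoms]

theorem mem_sAtoms {a : Atom} : a ∈ sAtoms S σ ↔ a ∈ σ.1 ∧ ¬ Problematic S σ a := by
  simp [sAtoms]

theorem pAtoms_subset : pAtoms S σ ⊆ σ.1 := fun _ ha => (mem_pAtoms.1 ha).1

theorem sAtoms_subset : sAtoms S σ ⊆ σ.1 := fun _ ha => (mem_sAtoms.1 ha).1

theorem mem_pAtoms_or_mem_sAtoms {a : Atom} (ha : a ∈ σ.1) :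
    a ∈ pAtoms S σ ∨ a ∈ sAtoms S σ := by
  rw [mem_pAtoms, mem_sAtoms]
  tauto

theorem mem_bridge {x : ℕ} : x ∈ bridge S σ ↔ x ∈ conjVars (sAtoms S σ) ∧
    (x ∈ conjVars (pAtoms S σ) ∨ (Harmless S σ x ∧ IsFrontier σ x)) := by
  simp [bridge]

theorem mem_bridge_of_mem_of_mem {x : ℕ} (hp : x ∈ conjVars (pAtoms S σ))
    (hs : x ∈ conjVars (sAtoms S σ)) : x ∈ bridge S σ :=
  mem_bridge.2 ⟨hs, Or.inl hp⟩

theorem harmless_or_harmful {x : ℕ} (hx : x ∈ conjVars σ.1) :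
    Harmless S σ x ∨ Harmful S σ x :=
  (em (commonAff S σ x = ∅)).imp (⟨hx, ·⟩) (⟨hx, ·⟩)

theorem harmless_of_mem_bridge {x : ℕ} (h : x ∈ bridge S σ) : Harmless S σ x := by
  obtain ⟨hs, hp | h⟩ := mem_bridge.1 h
  · refine (harmless_or_harmful (conjVars_subset sAtoms_subset hs)).resolve_right fun hx => ?_
    obtain ⟨a, ha, hxa⟩ := mem_conjVars.1 hs
    obtain ⟨b, hb, hxb⟩ := mem_conjVars.1 hp
    exact (mem_sAtoms.1 ha).2 <| .connected a b x (sAtoms_subset ha) (mem_pAtoms.1 hb).2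
      (mem_termVars.2 hxa) (mem_termVars.2 hxb) hx
  · exact h.1

theorem IsFrontier.mem_pAtoms_or_mem_bridge {x : ℕ} (hx : IsFrontier σ x) :
    x ∈ conjVars (pAtoms S σ) ∨ x ∈ bridge S σ := by
  obtain ⟨a, ha, hxa⟩ := mem_conjVars.1 hx.1
  refine (mem_pAtoms_or_mem_sAtoms (S := S) ha).imp (fun hp => mem_conjVars.2 ⟨a, hp, hxa⟩)
    fun hs => mem_bridge.2 ⟨mem_conjVars.2 ⟨a, hs, hxa⟩, Or.inr ⟨?_, hx⟩⟩
  exact (harmless_or_harmful hx.1).resolve_right fun h =>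
    (mem_sAtoms.1 hs).2 (.dangerous a x ha (mem_termVars.2 hxa) ⟨h, hx⟩)

theorem exists_isHom_body {I : Instance} {g h : ℕ → Value} (hg : IsHom g (pAtoms S σ) I)
    (hh : IsHom h (sAtoms S σ) I) (hgh : ∀ x ∈ bridge S σ, g x = h x) :
    ∃ u, IsHom u σ.1 I ∧ (∀ x ∈ conjVars (pAtoms S σ), u x = g x) ∧
      ∀ x ∈ conjVars (sAtoms S σ), u x = h x := by
  classical
  let u : ℕ → Value := fun x => if x ∈ conjVars (sAtoms S σ) then h x else g x
  have hus : ∀ x ∈ conjVars (sAtoms S σ), u x = h x := fun x hx => if_pos hx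
  have hup : ∀ x ∈ conjVars (pAtoms S σ), u x = g x := fun x hx => by
    by_cases hxs : x ∈ conjVars (sAtoms S σ)
    · rw [hus x hxs, hgh x (mem_bridge_of_mem_of_mem hx hxs)]
    · exact if_neg hxs
  refine ⟨u, fun a ha => ?_, hup, hus⟩
  exact (mem_pAtoms_or_mem_sAtoms (S := S) ha).elim ((isHom_congr hup).2 hg a)
    ((isHom_congr hus).2 hh a)

end Split

/-! ### The renamed head -/

/-- The variable of the head `H` that the variable `y` of its renamed copy stands for: the new
variables encode the place in `H` at which they were introduced. The value `0` is never used. -/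
def origin (S : Ontology) (H : Conj) (y : ℕ) : ℕ :=
  if y < freshVar S then y else
    let ij := (Nat.unpair (y - freshVar S)).2.unpair
    (((H[ij.1]?).bind fun a => a.2[ij.2]?).bind Sum.getRight?).getD 0

theorem origin_of_lt {S : Ontology} {H : Conj} {y : ℕ} (h : y < freshVar S) :
    origin S H y = y := if_pos h

/-- The new variable for the argument `j` of the atom `i` in the head of the rule number `k`. -/
def copyVar (S : Ontology) (k i j : ℕ) : ℕ := freshVar S + Nat.pair k (Nat.pair i j)

/-- The head of the rule number `k`, with every argument paired with its new name. -/
noncomputable def pairedHead (S : Ontology) (k : ℕ) (σ : Rule) : List (AtomOver (Term × Term)) :=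
  splitHead (bridge S σ) (copyVar S k) σ.2

/-- The arguments of the head that receive a new name, each paired with that name. -/
noncomputable def renamedPairs (S : Ontology) (k : ℕ) (σ : Rule) : List (Term × Term) :=
  ((pairedHead S k σ).flatMap Prod.snd).filter fun p => p.1 ≠ p.2

/-- The arguments of `Aux_σ`. -/
noncomputable def auxArgs (S : Ontology) (k : ℕ) (σ : Rule) : List Term :=
  (bridge S σ).map Term.var ++ (renamedPairs S k σ).map Prod.snd

/-- The variables of `σ` that the arguments of `Aux_σ` stand for, in the same order. -/
noncomputable def auxVars (S : Ontology) (k : ℕ) (σ : Rule) : List ℕ :=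
  bridge S σ ++ termVars ((renamedPairs S k σ).map Prod.fst)

/-- The head of `main(σ)`. -/
noncomputable def mainHead (S : Ontology) (k : ℕ) (σ : Rule) : Conj :=
  (pairedHead S k σ).map fun a => (a.1, a.2.map Prod.snd)

theorem mainRule_eq (S : Ontology) (k : ℕ) (σ : Rule) :
    mainRule S k σ = ((freshName S + k, auxArgs S k σ) :: pAtoms S σ, mainHead S k σ) := rfl

theorem map_fst_splitHead (B : List ℕ) (new : ℕ → ℕ → ℕ) (H : Conj) :
    (splitHead B new H).map (fun a => (a.1, a.2.map Prod.fst)) = H := by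
  refine List.ext_getElem (by simp [splitHead]) fun i _ _ => ?_
  simp only [splitHead, List.getElem_map, List.getElem_mapIdx]
  refine Prod.ext rfl (List.ext_getElem (by simp) fun j _ _ => ?_)
  simp only [List.getElem_map, List.getElem_mapIdx]
  split
  · simp_all
  · split <;> simp_all

theorem eq_or_renamed_of_mem_splitHead {B : List ℕ} {new : ℕ → ℕ → ℕ} {H : Conj}
    {a : AtomOver (Term × Term)} (ha : a ∈ splitHead B new H) {p : Term × Term} (hp : p ∈ a.2) :
    p.1 = p.2 ∨ ∃ x i j, x ∈ B ∧ p = (Term.var x, Term.var (new i j)) ∧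
      ((H[i]?).bind fun b => b.2[j]?) = some (Term.var x) := by
  obtain ⟨i, hi, rfl⟩ := List.mem_iff_getElem.1 ha
  obtain ⟨j, hj, rfl⟩ := List.mem_iff_getElem.1 hp
  simp only [splitHead, List.length_mapIdx, List.getElem_mapIdx] at hi hj ⊢
  split
  · exact Or.inl rfl
  · rename_i x hx
    split_ifs with h
    · refine Or.inr ⟨x, i, j, h.1, rfl, ?_⟩
      simp [List.getElem?_eq_getElem hi, List.getElem?_eq_getElem hj, hx]
    · exact Or.inl rfl

section MainRule

variable {S : Ontology} {k : ℕ} {σ : Rule}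

theorem map_fst_pairedHead : (pairedHead S k σ).map (fun a => (a.1, a.2.map Prod.fst)) = σ.2 :=
  map_fst_splitHead _ _ _

theorem mem_conjVars_head_of_mem_pairedHead {a : AtomOver (Term × Term)}
    (ha : a ∈ pairedHead S k σ) {p : Term × Term} (hp : p ∈ a.2) {x : ℕ}
    (hx : p.1 = Term.var x) : x ∈ conjVars σ.2 := by
  rw [← map_fst_pairedHead (S := S) (k := k) (σ := σ)]
  exact mem_conjVars.2 ⟨_, List.mem_map_of_mem ha, List.mem_map.2 ⟨p, hp, hx⟩⟩

theorem eq_or_renamed_of_mem_pairedHead {a : AtomOver (Term × Term)}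
    (ha : a ∈ pairedHead S k σ) {p : Term × Term} (hp : p ∈ a.2) :
    p.1 = p.2 ∨ ∃ x y, x ∈ bridge S σ ∧ p = (Term.var x, Term.var y) ∧ freshVar S ≤ y ∧
      origin S σ.2 y = x := by
  refine (eq_or_renamed_of_mem_splitHead ha hp).imp_right ?_
  rintro ⟨x, i, j, hx, rfl, hij⟩
  exact ⟨x, _, hx, rfl, Nat.le_add_right _ _, by simp [origin, copyVar, hij]⟩

theorem exists_of_mem_renamedPairs {p : Term × Term} (hp : p ∈ renamedPairs S k σ) :
    ∃ x y, x ∈ bridge S σ ∧ p = (Term.var x, Term.var y) ∧ freshVar S ≤ y ∧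
      origin S σ.2 y = x := by
  simp only [renamedPairs, List.mem_filter, List.mem_flatMap, decide_eq_true_eq] at hp
  obtain ⟨⟨a, ha, hp⟩, hne⟩ := hp
  exact (eq_or_renamed_of_mem_pairedHead ha hp).resolve_left hne

theorem map_origin_of_mem_pairedHead (hσ : σ ∈ S) {a : AtomOver (Term × Term)}
    (ha : a ∈ pairedHead S k σ) {p : Term × Term} (hp : p ∈ a.2) :
    Sum.map id (origin S σ.2) p.2 = p.1 := by
  rcases eq_or_renamed_of_mem_pairedHead ha hp with h | ⟨x, y, -, rfl, -, rfl⟩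
  · rw [← h]
    rcases hx : p.1 with c | x
    · rfl
    · have hxσ := mem_conjVars_head_of_mem_pairedHead ha hp hx
      simp [origin_of_lt (var_lt_freshVar hσ (Or.inr hxσ))]
  · rfl

theorem renameVars_origin_mainHead (hσ : σ ∈ S) :
    renameVars (origin S σ.2) (mainHead S k σ) = σ.2 := by
  conv_rhs => rw [← map_fst_pairedHead (S := S) (k := k) (σ := σ)]
  rw [renameVars, mainHead, List.map_map]
  refine List.map_congr_left fun a ha => Prod.ext rfl ?_
  simp only [Function.comp_apply, List.map_map]
  exact List.map_congr_left fun p hp => map_origin_of_mem_pairedHead hσ ha hp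

theorem map_origin_mem_head (hσ : σ ∈ S) {a : Atom} (ha : a ∈ mainHead S k σ) :
    (a.1, a.2.map (Sum.map id (origin S σ.2))) ∈ σ.2 := by
  have : _ ∈ renameVars (origin S σ.2) (mainHead S k σ) := List.mem_map_of_mem ha
  rwa [renameVars_origin_mainHead hσ] at this

theorem isHom_mainHead (hσ : σ ∈ S) {h : ℕ → Value} {I : Instance} :
    IsHom (h ∘ origin S σ.2) (mainHead S k σ) I ↔ IsHom h σ.2 I := by
  rw [← isHom_renameVars, renameVars_origin_mainHead hσ]

theorem origin_mem_conjVars_head (hσ : σ ∈ S) {y : ℕ} (hy : y ∈ conjVars (mainHead S k σ)) :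
    origin S σ.2 y ∈ conjVars σ.2 := by
  simpa only [renameVars_origin_mainHead hσ] using
    mem_conjVars_renameVars (o := origin S σ.2) hy

theorem bridge_lt_freshVar (hσ : σ ∈ S) {x : ℕ} (hx : x ∈ bridge S σ) : x < freshVar S :=
  var_lt_freshVar hσ (Or.inl (harmless_of_mem_bridge hx).1)

theorem map_origin_auxArgs (hσ : σ ∈ S) :
    (auxArgs S k σ).map (Sum.map id (origin S σ.2)) = (auxVars S k σ).map Term.var := by
  rw [auxArgs, auxVars, List.map_append, List.map_append, List.map_map]
  congr 1
  · refine List.map_congr_left fun x hx => ?_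
    simp [origin_of_lt (bridge_lt_freshVar hσ hx)]
  · have H := fun p => exists_of_mem_renamedPairs (S := S) (k := k) (σ := σ) (p := p)
    generalize renamedPairs S k σ = l at H
    induction l with
    | nil => rfl
    | cons p l ih =>
      obtain ⟨x, y, -, rfl, -, rfl⟩ := H p List.mem_cons_self
      simpa [termVars] using ih fun p hp => H p (List.mem_cons_of_mem _ hp)

theorem map_valueOf_auxArgs (hσ : σ ∈ S) (h : ℕ → Value) :
    (auxArgs S k σ).map (valueOf (h ∘ origin S σ.2)) = (auxVars S k σ).map h := by
  rw [valueOf_comp, ← List.map_map, map_origin_auxArgs hσ, List.map_map]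
  rfl

theorem mem_auxVars {x : ℕ} : x ∈ auxVars S k σ ↔ x ∈ bridge S σ := by
  rw [auxVars, List.mem_append, or_iff_left_iff_imp, mem_termVars, List.mem_map]
  rintro ⟨p, hp, hx⟩
  obtain ⟨x', y, h, rfl, -⟩ := exists_of_mem_renamedPairs hp
  cases hx
  exact h

theorem var_mem_auxArgs {x : ℕ} (hx : x ∈ bridge S σ) : Term.var x ∈ auxArgs S k σ :=
  List.mem_append_left _ (List.mem_map_of_mem hx)

theorem origin_mem_bridge (hσ : σ ∈ S) {y : ℕ} (hy : Term.var y ∈ auxArgs S k σ) :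
    origin S σ.2 y ∈ bridge S σ := by
  have := List.mem_map_of_mem (f := Sum.map id (origin S σ.2)) hy
  rw [map_origin_auxArgs hσ] at this
  exact mem_auxVars.1 (by simpa using this)

theorem lt_freshVar_or_mem_auxArgs (hσ : σ ∈ S) {y : ℕ} (hy : y ∈ conjVars (mainHead S k σ)) :
    y < freshVar S ∨ Term.var y ∈ auxArgs S k σ := by
  obtain ⟨b, hb, hy⟩ := mem_conjVars.1 hy
  obtain ⟨a, ha, rfl⟩ := List.mem_map.1 hb
  obtain ⟨p, hp, hpy⟩ := List.mem_map.1 hy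
  rcases eq_or_renamed_of_mem_pairedHead ha hp with h | ⟨x, y', hx, rfl, hy', rfl⟩
  · left
    exact var_lt_freshVar hσ
      (Or.inr (mem_conjVars_head_of_mem_pairedHead ha hp (h.trans hpy)))
  · right
    have hne : origin S σ.2 y' ≠ y' := ((bridge_lt_freshVar hσ hx).trans_le hy').ne
    refine List.mem_append_right _ (List.mem_map.2 ⟨_, List.mem_filter.2 ⟨?_, ?_⟩, hpy⟩)
    · exact List.mem_flatMap.2 ⟨a, ha, hp⟩
    · simpa using hne

theorem mem_conjVars_mainRule_body {x : ℕ} :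
    x ∈ conjVars (mainRule S k σ).1 ↔ Term.var x ∈ auxArgs S k σ ∨ x ∈ conjVars (pAtoms S σ) := by
  simp [mainRule_eq, mem_conjVars]

theorem mainHead_name_lt_freshName (hσ : σ ∈ S) : ∀ a ∈ mainHead S k σ, a.1 < freshName S :=
  fun a ha => name_lt_freshName (a := (a.1, a.2.map (Sum.map id (origin S σ.2)))) hσ
    (Or.inr (map_origin_mem_head hσ ha))

end MainRule

theorem getElem?_mainPart {S : Ontology} {k : ℕ} :
    (mainPart S)[k]? = (S[k]?).map (mainRule S k) :=
  List.getElem?_mapIdx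

theorem mem_mainPart {S : Ontology} {ρ : Rule} :
    ρ ∈ mainPart S ↔ ∃ k σ, S[k]? = some σ ∧ mainRule S k σ = ρ := by
  simp only [List.mem_iff_getElem?, getElem?_mainPart, Option.map_eq_some_iff]

/-! ### Auxiliary facts -/

/-- Renames predicates so that the names of the predicates `Aux_σ` are free: the database and the
query may use these names. -/
def shiftName (S : Ontology) (n : ℕ) : ℕ := if n < freshName S then n else n + S.length

theorem shiftName_of_lt {S : Ontology} {n : ℕ} (h : n < freshName S) : shiftName S n = n :=
  if_pos h

theorem shiftName_injective (S : Ontology) : Function.Injective (shiftName S) := by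
  intro m n h
  unfold shiftName at h
  split_ifs at h <;> omega

theorem shiftName_ne {S : Ontology} {n k : ℕ} (hk : k < S.length) :
    shiftName S n ≠ freshName S + k := by
  unfold shiftName
  split_ifs <;> omega

/-- The atoms of `A` with their predicates renamed by `shiftName S`. -/
def shiftAtoms {α : Type} (S : Ontology) (A : List (AtomOver α)) : List (AtomOver α) :=
  A.map fun a => (shiftName S a.1, a.2)

/-- The query whose certain answers are the arguments of the facts over `Aux_σ`. -/
noncomputable def auxQuery (S : Ontology) (k : ℕ) (σ : Rule) : CQ := (auxVars S k σ, sAtoms S σ)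

/-- The names of the predicates `Aux_σ`, each with its query. -/
noncomputable def auxQueries (S : Ontology) : List (ℕ × CQ) :=
  S.mapIdx fun k σ => (freshName S + k, auxQuery S k σ)

theorem mem_auxQueries {S : Ontology} {n : ℕ} {q : CQ} : (n, q) ∈ auxQueries S ↔
    ∃ k σ, S[k]? = some σ ∧ freshName S + k = n ∧ auxQuery S k σ = q := by
  simp only [auxQueries, List.mem_iff_getElem?, List.getElem?_mapIdx, Option.map_eq_some_iff,
    Prod.mk.injEq]

theorem auxQuery_wellFormed (S : Ontology) (k : ℕ) (σ : Rule) : (auxQuery S k σ).WellFormed :=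
  fun _ hx => (mem_bridge.1 (mem_auxVars.1 hx)).1

/-- The constants of a database and of the heads of an ontology; they are the only constants that
the chase produces. -/
def domain (D : Database) (S : Ontology) : List ℕ :=
  D.flatMap Prod.snd ++ S.flatMap fun σ => σ.2.flatMap fun a => a.2.filterMap Sum.getLeft?

theorem mem_domain_of_mem_database {D : Database} {S : Ontology} {a : Fact} {c : ℕ} (ha : a ∈ D)
    (hc : c ∈ a.2) : c ∈ domain D S :=
  List.mem_append_left _ (List.mem_flatMap.2 ⟨a, ha, hc⟩)

theorem mem_domain_of_mem_head {D : Database} {S : Ontology} {σ : Rule} {a : Atom} {c : ℕ}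
    (hσ : σ ∈ S) (ha : a ∈ σ.2) (hc : Term.const c ∈ a.2) : c ∈ domain D S :=
  List.mem_append_right _ (List.mem_flatMap.2 ⟨σ, hσ, List.mem_flatMap.2
    ⟨a, ha, List.mem_filterMap.2 ⟨_, hc, rfl⟩⟩⟩)

/-- The tuples of a given length over a list, as a list. -/
def tuples {α : Type} (U : List α) : ℕ → List (List α)
  | 0 => [[]]
  | n + 1 => (tuples U n).flatMap fun t => U.map fun u => u :: t

theorem mem_tuples {α : Type} {U : List α} {n : ℕ} {t : List α} :
    t ∈ tuples U n ↔ t.length = n ∧ ∀ c ∈ t, c ∈ U := by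
  induction n generalizing t with
  | zero => cases t <;> simp [tuples]
  | succ n ih =>
    rcases t with _ | ⟨u, t⟩
    · simp [tuples]
    · simp [tuples, ih, and_comm, and_left_comm]

/-- The database `D`, with its predicates renamed, and the auxiliary facts `A`. -/
def auxDatabase (S : Ontology) (D A : Database) : Database := shiftAtoms S D ++ A

/-- The fact `a` over some predicate `Aux_σ` is a certain answer to the query of that predicate
over the main part, given the auxiliary facts `A`. -/
def AuxStep (S : Ontology) (D A : Database) (a : Fact) : Prop :=
  ∃ q : CQ, (a.1, q) ∈ auxQueries S ∧ a.2 ∈ tuples (domain D S) q.1.length ∧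
    a.2 ∈ cert q (auxDatabase S D A) (mainPart S)

/-! ### Soundness -/

/-- The extension of an instance by all the facts over the predicates `Aux_σ`: the answers to
their queries over the instance. -/
def auxModel (S : Ontology) (I : Instance) : Instance :=
  {a | (∃ b ∈ I, a = (shiftName S b.1, b.2)) ∨
    ∃ k σ h, S[k]? = some σ ∧ IsHom h (sAtoms S σ) I ∧
      a = (freshName S + k, (auxVars S k σ).map h)}

section Soundness

variable {S : Ontology} {I : Instance}

theorem shiftName_mem_auxModel {n : ℕ} {ts : List Value} :
    (shiftName S n, ts) ∈ auxModel S I ↔ (n, ts) ∈ I := by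
  constructor
  · rintro (⟨b, hb, h⟩ | ⟨k, σ, h, hk, -, hn⟩)
    · obtain ⟨h₁, rfl⟩ := Prod.mk.inj h
      rwa [shiftName_injective S h₁]
    · exact absurd (Prod.mk.inj hn).1 (shiftName_ne (List.getElem?_eq_some_iff.1 hk).1)
  · exact fun h => Or.inl ⟨_, h, rfl⟩

theorem auxName_mem_auxModel {k : ℕ} {σ : Rule} (hk : S[k]? = some σ) {ts : List Value} :
    (freshName S + k, ts) ∈ auxModel S I ↔
      ∃ h, IsHom h (sAtoms S σ) I ∧ ts = (auxVars S k σ).map h := by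
  constructor
  · rintro (⟨b, -, hb⟩ | ⟨k', σ', h, hk', hs, heq⟩)
    · exact absurd (Prod.mk.inj hb).1.symm (shiftName_ne (List.getElem?_eq_some_iff.1 hk).1)
    · obtain ⟨hkk', rfl⟩ := Prod.mk.inj heq
      obtain rfl : k = k' := Nat.add_left_cancel hkk'
      obtain rfl : σ = σ' := Option.some.inj (hk.symm.trans hk')
      exact ⟨h, hs, rfl⟩
  · rintro ⟨h, hs, rfl⟩
    exact Or.inr ⟨k, σ, h, hk, hs, rfl⟩

theorem isHom_auxModel {h : ℕ → Value} {A : Conj} (hA : ∀ a ∈ A, a.1 < freshName S) :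
    IsHom h A (auxModel S I) ↔ IsHom h A I := by
  refine forall₂_congr fun a ha => ?_
  conv_lhs => rw [← shiftName_of_lt (hA a ha)]
  exact shiftName_mem_auxModel

theorem isHom_shiftAtoms_auxModel {h : ℕ → Value} {A : Conj} :
    IsHom h (shiftAtoms S A) (auxModel S I) ↔ IsHom h A I := by
  simp only [IsHom, shiftAtoms, List.forall_mem_map, shiftName_mem_auxModel]

theorem exists_isHom_body_of_isHom_mainRule {k : ℕ} {σ : Rule} (hk : S[k]? = some σ)
    {g : ℕ → Value} (hg : IsHom g (mainRule S k σ).1 (auxModel S I)) :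
    ∃ u, IsHom u σ.1 I ∧ (∀ x ∈ conjVars (pAtoms S σ), u x = g x) ∧
      ∀ y, Term.var y ∈ auxArgs S k σ → u (origin S σ.2 y) = g y := by
  have hσ : σ ∈ S := List.mem_of_getElem? hk
  obtain ⟨haux, hgp⟩ := List.forall_mem_cons.1 hg
  replace hgp := (isHom_auxModel fun a ha => name_lt_freshName hσ (.inl (pAtoms_subset ha))).1 hgp
  obtain ⟨h, hhs, hargs⟩ := (auxName_mem_auxModel hk).1 haux
  rw [← map_valueOf_auxArgs hσ] at hargs
  have hgh : ∀ y, Term.var y ∈ auxArgs S k σ → g y = h (origin S σ.2 y) :=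
    fun y hy => List.map_inj_left.1 hargs _ hy
  obtain ⟨u, hu, hup, hus⟩ := exists_isHom_body hgp hhs fun x hx => by
    rw [hgh x (var_mem_auxArgs hx), origin_of_lt (bridge_lt_freshVar hσ hx)]
  refine ⟨u, hu, hup, fun y hy => ?_⟩
  rw [hgh y hy, hus _ (mem_bridge.1 (origin_mem_bridge hσ hy)).1]

theorem satRule_auxModel {k : ℕ} {σ : Rule} (hk : S[k]? = some σ) (hI : SatRule I σ) :
    SatRule (auxModel S I) (mainRule S k σ) := by
  have hσ : σ ∈ S := List.mem_of_getElem? hk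
  intro g hg
  obtain ⟨u, hu, hup, hua⟩ := exists_isHom_body_of_isHom_mainRule hk hg
  obtain ⟨h, hf, hh⟩ := hI u hu
  refine ⟨h ∘ origin S σ.2, fun x ⟨hx₁, hx₂⟩ => ?_,
    (isHom_auxModel (mainHead_name_lt_freshName hσ)).2 ((isHom_mainHead hσ).2 hh)⟩
  have hox := origin_mem_conjVars_head hσ hx₂
  rw [Function.comp_apply]
  rcases mem_conjVars_mainRule_body.1 hx₁ with hxa | hxp
  · have hxs := (mem_bridge.1 (origin_mem_bridge hσ hxa)).1
    rw [hf _ ⟨conjVars_subset sAtoms_subset hxs, hox⟩, hua x hxa]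
  · have hxσ := conjVars_subset pAtoms_subset hxp
    rw [origin_of_lt (var_lt_freshVar hσ (Or.inl hxσ))] at hox ⊢
    rw [hf x ⟨hxσ, hox⟩, hup x hxp]

theorem isModel_auxModel {D A : Database} (hI : IsModel D S I)
    (hA : ∀ a ∈ A, (a.1, a.2.map Value.const) ∈ auxModel S I) :
    IsModel (auxDatabase S D A) (mainPart S) (auxModel S I) := by
  refine ⟨fun a ha => ?_, fun ρ hρ => ?_⟩
  · rcases List.mem_append.1 ha with ha | ha
    · obtain ⟨b, hb, rfl⟩ := List.mem_map.1 ha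
      exact shiftName_mem_auxModel.2 (hI.1 b hb)
    · exact hA a ha
  · obtain ⟨k, σ, hk, rfl⟩ := mem_mainPart.1 hρ
    exact satRule_auxModel hk (hI.2 σ (List.mem_of_getElem? hk))

/-- Lists built from the end by the rule `P`: every element is derivable from the list of those
after it. -/
inductive IsDerivation {α : Type*} (P : List α → α → Prop) : List α → Prop
  | nil : IsDerivation P []
  | cons {a : α} {A : List α} : P A a → IsDerivation P A → IsDerivation P (a :: A)

theorem mem_auxModel_of_isDerivation {D A : Database} (hI : IsModel D S I)
    (hA : IsDerivation (AuxStep S D) A) :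
    ∀ a ∈ A, (a.1, a.2.map Value.const) ∈ auxModel S I := by
  induction hA with
  | nil => simp
  | @cons a A ha _ ih =>
    refine List.forall_mem_cons.2 ⟨?_, ih⟩
    obtain ⟨q, hq, -, hc⟩ := ha
    obtain ⟨k, σ, hk, hn, rfl⟩ := mem_auxQueries.1 hq
    obtain ⟨h, hh, ht⟩ := hc _ (isModel_auxModel hI ih)
    rw [← hn, auxName_mem_auxModel hk]
    refine ⟨h, (isHom_auxModel fun a ha => ?_).1 hh, ht.symm⟩
    exact name_lt_freshName (List.mem_of_getElem? hk) (Or.inl (sAtoms_subset ha))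

theorem cert_of_cert_mainPart {D A : Database} (hA : IsDerivation (AuxStep S D) A) {q : CQ}
    {c : List ℕ} (hc : c ∈ cert (q.1, shiftAtoms S q.2) (auxDatabase S D A) (mainPart S)) :
    c ∈ cert q D S := by
  intro I hI
  obtain ⟨h, hh, hq⟩ := hc _ (isModel_auxModel hI (mem_auxModel_of_isDerivation hI hA))
  exact ⟨h, isHom_shiftAtoms_auxModel.1 hh, hq⟩

end Soundness

/-! ### The Skolem chase -/

/-- The null for the existential variable `x` of the rule number `k`, applied to the values `l` of
the body variables. Nulls code Skolem terms. -/
def skolemNull (k x : ℕ) (l : List Value) : Value := Value.null (Encodable.encode (k, x, l))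

theorem skolemNull_inj {k x k' x' : ℕ} {l l' : List Value} :
    skolemNull k x l = skolemNull k' x' l' ↔ k = k' ∧ x = x' ∧ l = l' := by
  simp [skolemNull]

/-- The extension of an assignment `h` of the body variables of the rule `ρ`, number `k`, to the
existential variables. -/
def skolem (k : ℕ) (ρ : Rule) (h : ℕ → Value) (x : ℕ) : Value :=
  if x ∈ conjVars ρ.1 then h x else skolemNull k x ((conjVars ρ.1).map h)

/-- The Skolem chase of the database `D` with the ontology `R`, a universal model. -/
inductive Chase (D : Database) (R : Ontology) : Instance
  | base {a : Fact} (ha : a ∈ D) : Chase D R (a.1, a.2.map Value.const)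
  | step {k : ℕ} {ρ : Rule} {h : ℕ → Value} {a : Atom} (hk : R[k]? = some ρ)
      (hb : ∀ b ∈ ρ.1, Chase D R (b.1, b.2.map (valueOf h))) (ha : a ∈ ρ.2) :
      Chase D R (a.1, a.2.map (valueOf (skolem k ρ h)))

theorem lt_encode_of_null_mem {l : List Value} {m : ℕ} (h : Value.null m ∈ l) :
    m < Encodable.encode l := by
  induction l with
  | nil => simp at h
  | cons v l ih =>
    rw [Encodable.encode_list_cons]
    refine Nat.lt_succ_of_le ?_
    rcases List.mem_cons.1 h with rfl | h
    · have hm : m ≤ Encodable.encode (Value.null m) := by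
        simp only [Encodable.encode_inr, Encodable.encode_nat]
        omega
      exact hm.trans (Nat.left_le_pair _ _)
    · exact (ih h).le.trans (Nat.right_le_pair _ _)

theorem lt_encode_skolem_of_null_mem {k x : ℕ} {l : List Value} {m : ℕ}
    (h : Value.null m ∈ l) : m < Encodable.encode (k, x, l) :=
  (lt_encode_of_null_mem h).trans_le ((Nat.right_le_pair _ _).trans (Nat.right_le_pair _ _))

/-- The value of the null `n`, read as a Skolem term, under the interpretation `E` of the Skolem
functions. The default `Value.const 0` is never used for the nulls of the chase: a Skolem term has
a larger code than the nulls in it. -/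
def interpNull (E : ℕ → ℕ → List Value → Value) (n : ℕ) : Value :=
  match (Encodable.decode n : Option (ℕ × ℕ × List Value)) with
  | none => Value.const 0
  | some (k, x, l) => E k x (l.map fun v =>
      match v with
      | Sum.inl c => Value.const c
      | Sum.inr m => if _h : m < n then interpNull E m else Value.const 0)
termination_by n

/-- The extension of `interpNull` to all values; constants are fixed. -/
def interp (E : ℕ → ℕ → List Value → Value) : Value → Value := Sum.elim Value.const (interpNull E)

theorem interp_skolemNull (E : ℕ → ℕ → List Value → Value) (k x : ℕ) (l : List Value) :
    interp E (skolemNull k x l) = E k x (l.map (interp E)) := by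
  change interpNull E _ = _
  rw [interpNull, Encodable.encodek]
  refine congrArg (E k x) (List.map_congr_left fun v hv => ?_)
  rcases v with c | m
  · rfl
  · exact dif_pos (lt_encode_skolem_of_null_mem hv)

/-- The assignment of the values `l` to the variables `V`; the default value is that of the
variables outside `V`. -/
def assignment (V : List ℕ) (l : List Value) (x : ℕ) : Value := l.getD (V.idxOf x) (Value.const 0)

theorem assignment_map {V : List ℕ} {h : ℕ → Value} {x : ℕ} (hx : x ∈ V) :
    assignment V (V.map h) x = h x := by
  have := List.idxOf_lt_length_of_mem hx
  simp [assignment, List.getD, List.getElem?_eq_getElem this]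

theorem exists_skolem_interpretation {R : Ontology} {J : Instance}
    (hJ : ∀ ρ ∈ R, SatRule J ρ) : ∃ E : ℕ → ℕ → List Value → Value,
      ∀ k ρ h, R[k]? = some ρ → IsHom (interp E ∘ h) ρ.1 J →
        IsHom (interp E ∘ skolem k ρ h) ρ.2 J := by
  have hext : ∀ ρ ∈ R, ∀ g, IsHom g ρ.1 J →
    ∃ g', (∀ x, IsFrontier ρ x → g' x = g x) ∧ IsHom g' ρ.2 J := hJ
  choose! ext hfrontier hhead using hext
  let E : ℕ → ℕ → List Value → Value := fun k x l =>
    (R[k]?).elim (Value.const 0) fun ρ => ext ρ (assignment (conjVars ρ.1) l) x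
  refine ⟨E, fun k ρ h hk hbody => ?_⟩
  let g := assignment (conjVars ρ.1) ((conjVars ρ.1).map (interp E ∘ h))
  have hg : ∀ x ∈ conjVars ρ.1, g x = (interp E ∘ h) x := fun x hx => assignment_map hx
  have hgJ : IsHom g ρ.1 J := (isHom_congr hg).2 hbody
  have hρ : ρ ∈ R := List.mem_of_getElem? hk
  refine (isHom_congr fun x hx => ?_).1 (hhead ρ hρ g hgJ)
  by_cases hxb : x ∈ conjVars ρ.1
  · rw [hfrontier ρ hρ g hgJ x ⟨hxb, hx⟩, hg x hxb, Function.comp_apply, Function.comp_apply,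
      skolem, if_pos hxb]
  · rw [Function.comp_apply, skolem, if_neg hxb, interp_skolemNull]
    simp only [E, hk, Option.elim, g, List.map_map]

theorem exists_hom_of_isModel {D : Database} {R : Ontology} {J : Instance} (hJ : IsModel D R J) :
    ∃ φ : Value → Value, (∀ c, φ (Value.const c) = Value.const c) ∧
      ∀ a, Chase D R a → (a.1, a.2.map φ) ∈ J := by
  obtain ⟨E, hE⟩ := exists_skolem_interpretation hJ.2
  refine ⟨interp E, fun _ => rfl, fun a ha => ?_⟩
  induction ha with
  | base ha =>
    rw [List.map_map]
    exact hJ.1 _ ha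
  | @step k ρ h a hk _ ha ih =>
    simp only [map_map_valueOf (φ := interp E) fun _ => rfl] at ih ⊢
    exact hE k ρ h hk ih a ha

theorem mem_cert_of_mem_evalCQ_chase {D : Database} {R : Ontology} {q : CQ} {c : List ℕ}
    (h : c ∈ evalCQ q (Chase D R)) : c ∈ cert q D R := by
  intro J hJ
  obtain ⟨φ, hφ, hJ⟩ := exists_hom_of_isModel hJ
  obtain ⟨h, hh, hq⟩ := h
  refine ⟨φ ∘ h, fun a ha => ?_, ?_⟩
  · rw [← map_map_valueOf hφ]
    exact hJ _ (hh a ha)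
  · rw [← List.map_map, hq, List.map_map]
    exact List.map_congr_left fun c _ => hφ c

/-! ### Nulls in the chase of the main part -/

/-- The null `v` is due to an existential variable that affects the position `π`. -/
def NullAt (S : Ontology) (π : Position) (v : Value) : Prop :=
  ∃ k z l ρ, v = skolemNull k z l ∧ S[k]? = some ρ ∧ Affected S ρ z π

/-- The atoms whose arguments are constants from `U` or nulls at positions that they affect. -/
def wellPlaced (S : Ontology) (U : List ℕ) : Instance :=
  {a | ∀ i v, a.2[i]? = some v →
    (∃ c ∈ U, v = Value.const c) ∨ NullAt S ⟨a.1, a.2.length, i⟩ v}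

section WellPlaced

variable {S : Ontology} {U : List ℕ} {k : ℕ} {σ : Rule} {h : ℕ → Value}

theorem exists_affected_of_nullAt {B : Conj} {x : ℕ} {v : Value} (hx : x ∈ conjVars B)
    (hv : ∀ π, OccursAt x B π → NullAt S π v) :
    ∃ k z l ρ, v = skolemNull k z l ∧ S[k]? = some ρ ∧ ∀ π, OccursAt x B π → Affected S ρ z π := by
  obtain ⟨π₀, hπ₀⟩ := mem_conjVars_iff_occursAt.1 hx
  obtain ⟨k, z, l, ρ, rfl, hk, -⟩ := hv π₀ hπ₀
  refine ⟨k, z, l, ρ, rfl, hk, fun π hπ => ?_⟩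
  obtain ⟨k', z', l', ρ', heq, hk', hz'⟩ := hv π hπ
  obtain ⟨rfl, rfl, -⟩ := skolemNull_inj.1 heq
  obtain rfl : ρ = ρ' := Option.some.inj (hk.symm.trans hk')
  exact hz'

theorem NullAt.propagate {x : ℕ} {v : Value} {π : Position} (hσ : σ ∈ S) (hx : IsFrontier σ x)
    (hπ : OccursAt x σ.2 π) (hv : ∀ π', OccursAt x σ.1 π' → NullAt S π' v) : NullAt S π v := by
  obtain ⟨k, z, l, ρ, hvn, hk, hz⟩ := exists_affected_of_nullAt hx.1 hv
  exact ⟨k, z, l, ρ, hvn, hk, .propagate σ x hσ hx hπ hz⟩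

theorem NullAt.skolemNull {z : ℕ} {π : Position} (hk : S[k]? = some σ) (hz : IsExVar σ z)
    (hπ : OccursAt z σ.2 π) (l : List Value) : NullAt S π (skolemNull k z l) :=
  ⟨k, z, l, σ, rfl, hk, .intro (List.mem_of_getElem? hk) hz hπ⟩

theorem const_or_nullAt_of_isHom {B : Conj} (hB : IsHom h B (wellPlaced S U)) {x : ℕ}
    {π : Position} (hπ : OccursAt x B π) :
    (∃ c ∈ U, h x = Value.const c) ∨ NullAt S π (h x) := by
  obtain ⟨n, m, i⟩ := π
  obtain ⟨b, hb, rfl, rfl, hi⟩ := hπ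
  simpa only [List.length_map] using hB b hb i (h x) (by simp [hi])

theorem exists_const_of_mem_bridge (hσ : IsHom h σ.1 (wellPlaced S U)) {x : ℕ}
    (hx : x ∈ bridge S σ) : ∃ c ∈ U, h x = Value.const c := by
  by_contra hc
  obtain ⟨hxσ, hempty⟩ := harmless_of_mem_bridge hx
  obtain ⟨_, z, _, ρ, -, -, hz⟩ := exists_affected_of_nullAt hxσ fun π hπ =>
    (const_or_nullAt_of_isHom hσ hπ).resolve_left hc
  exact Set.eq_empty_iff_forall_notMem.1 hempty (ρ, z) hz

theorem exists_const_of_mem_auxArgs (hbody : IsHom h (mainRule S k σ).1 (wellPlaced S U)) {y : ℕ}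
    (hy : Term.var y ∈ auxArgs S k σ) : ∃ c ∈ U, h y = Value.const c := by
  obtain ⟨j, hj⟩ := List.getElem?_of_mem hy
  refine (const_or_nullAt_of_isHom hbody (π := ⟨freshName S + k, (auxArgs S k σ).length, j⟩)
    ⟨_, List.mem_cons_self, rfl, rfl, hj⟩).resolve_right ?_
  rintro ⟨_, _, _, _, -, -, haff⟩
  exact absurd haff.name_lt_freshName (by simp)

theorem occursAt_pAtoms_of_notMem_bridge {x : ℕ} {π : Position} (hx : x ∈ conjVars (pAtoms S σ))
    (hxb : x ∉ bridge S σ) (hπ : OccursAt x σ.1 π) : OccursAt x (pAtoms S σ) π := by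
  obtain ⟨b, hb, hbπ⟩ := hπ
  refine ⟨b, (mem_pAtoms_or_mem_sAtoms hb).resolve_right fun hbs => hxb ?_, hbπ⟩
  exact mem_bridge_of_mem_of_mem hx (mem_conjVars.2 ⟨b, hbs, List.mem_of_getElem? hbπ.2.2⟩)

theorem skolem_const_or_nullAt (hk : S[k]? = some σ)
    (hbody : IsHom h (mainRule S k σ).1 (wellPlaced S U)) {y : ℕ}
    (hya : Term.var y ∉ auxArgs S k σ) {π : Position} (hπ : OccursAt y σ.2 π) :
    (∃ c ∈ U, skolem k (mainRule S k σ) h y = Value.const c) ∨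
      NullAt S π (skolem k (mainRule S k σ) h y) := by
  have hy₂ : y ∈ conjVars σ.2 := mem_conjVars_iff_occursAt.2 ⟨π, hπ⟩
  have hyb : y ∉ bridge S σ := fun hy => hya (var_mem_auxArgs hy)
  unfold skolem
  split_ifs with hy
  · have hyp := (mem_conjVars_mainRule_body.1 hy).resolve_left hya
    have hp : IsHom h (pAtoms S σ) (wellPlaced S U) := fun a ha =>
      hbody a (List.mem_cons_of_mem _ ha)
    refine or_iff_not_imp_left.2 fun hc => NullAt.propagate (List.mem_of_getElem? hk)
      ⟨conjVars_subset pAtoms_subset hyp, hy₂⟩ hπ fun π' hπ' => ?_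
    exact (const_or_nullAt_of_isHom hp
      (occursAt_pAtoms_of_notMem_bridge hyp hyb hπ')).resolve_left hc
  · refine Or.inr (.skolemNull hk ⟨hy₂, fun hy₁ => hy (mem_conjVars_mainRule_body.2 ?_)⟩ hπ _)
    exact Or.inr ((IsFrontier.mem_pAtoms_or_mem_bridge ⟨hy₁, hy₂⟩).resolve_right hyb)

theorem isHom_skolem_mainHead (hk : S[k]? = some σ)
    (hU : ∀ a ∈ σ.2, ∀ c, Term.const c ∈ a.2 → c ∈ U)
    (hbody : IsHom h (mainRule S k σ).1 (wellPlaced S U)) :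
    IsHom (skolem k (mainRule S k σ) h) (mainHead S k σ) (wellPlaced S U) := by
  have hσ := List.mem_of_getElem? hk
  intro a ha i v hv
  have haσ := map_origin_mem_head hσ ha
  simp only [List.getElem?_map, Option.map_eq_some_iff] at hv
  obtain ⟨t, ht, rfl⟩ := hv
  simp only [List.length_map]
  rcases t with c | y
  · exact .inl ⟨c, hU _ haσ c (List.mem_map.2 ⟨_, List.mem_of_getElem? ht, rfl⟩), rfl⟩
  by_cases hya : Term.var y ∈ auxArgs S k σ
  · left
    rw [valueOf_var, skolem, if_pos (mem_conjVars_mainRule_body.2 (Or.inl hya))]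
    exact exists_const_of_mem_auxArgs hbody hya
  · refine skolem_const_or_nullAt hk hbody hya ⟨_, haσ, rfl, by simp, ?_⟩
    have hlt := (lt_freshVar_or_mem_auxArgs hσ
      (mem_conjVars.2 ⟨a, ha, List.mem_of_getElem? ht⟩)).resolve_right hya
    simp [ht, origin_of_lt hlt]

end WellPlaced

/-! ### Completeness -/

section Completeness

variable {S : Ontology} {D A : Database}

theorem chase_subset_wellPlaced (hA : ∀ a ∈ A, ∀ c ∈ a.2, c ∈ domain D S) :
    Chase (auxDatabase S D A) (mainPart S) ⊆ wellPlaced S (domain D S) := by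
  intro a ha
  induction ha with
  | @base a ha =>
    intro i v hv
    simp only [List.getElem?_map, Option.map_eq_some_iff] at hv
    obtain ⟨c, hc, rfl⟩ := hv
    replace hc := List.mem_of_getElem? hc
    refine Or.inl ⟨c, ?_, rfl⟩
    rcases List.mem_append.1 ha with ha | ha
    · obtain ⟨b, hb, rfl⟩ := List.mem_map.1 ha
      exact mem_domain_of_mem_database hb hc
    · exact hA a ha c hc
  | @step k ρ h a hk _ ha ih =>
    rw [getElem?_mainPart, Option.map_eq_some_iff] at hk
    obtain ⟨σ, hk, rfl⟩ := hk
    exact isHom_skolem_mainHead hk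
      (fun _ hb _ hc => mem_domain_of_mem_head (List.mem_of_getElem? hk) hb hc) ih a ha

/-- The chase of the main part without the auxiliary facts. -/
def chaseReduct (S : Ontology) (D A : Database) : Instance :=
  {a | Chase (auxDatabase S D A) (mainPart S) (shiftName S a.1, a.2)}

theorem isHom_chaseReduct {h : ℕ → Value} {B : Conj} (hB : ∀ a ∈ B, a.1 < freshName S) :
    IsHom h B (chaseReduct S D A) ↔ IsHom h B (Chase (auxDatabase S D A) (mainPart S)) := by
  refine forall₂_congr fun a ha => ?_
  change Chase _ _ (shiftName S a.1, _) ↔ Chase _ _ _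
  rw [shiftName_of_lt (hB a ha)]

section SatRule

variable {k : ℕ} {σ : Rule} {h : ℕ → Value}

theorem exists_auxFact (hA : ∀ a ∈ A, ∀ c ∈ a.2, c ∈ domain D S)
    (hsat : ∀ a, AuxStep S D A a → a ∈ A) (hk : S[k]? = some σ)
    (hh : IsHom h σ.1 (Chase (auxDatabase S D A) (mainPart S))) :
    ∃ t, (auxVars S k σ).map h = t.map Value.const ∧ (freshName S + k, t) ∈ A := by
  have hconst : ∀ x ∈ bridge S σ, ∃ c ∈ domain D S, h x = Value.const c := fun x hx =>
    exists_const_of_mem_bridge (fun a ha => chase_subset_wellPlaced hA (hh a ha)) hx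
  choose! c hc hhc using hconst
  have ht : (auxVars S k σ).map h = ((auxVars S k σ).map c).map Value.const := by
    rw [List.map_map]
    exact List.map_congr_left fun x hx => hhc x (mem_auxVars.1 hx)
  refine ⟨_, ht, hsat _ ⟨auxQuery S k σ, mem_auxQueries.2 ⟨k, σ, hk, rfl, rfl⟩,
    mem_tuples.2 ⟨by simp [auxQuery], ?_⟩, mem_cert_of_mem_evalCQ_chase ⟨h, ?_, ht⟩⟩⟩
  · exact List.forall_mem_map.2 fun x hx => hc x (mem_auxVars.1 hx)
  · exact fun a ha => hh a (sAtoms_subset ha)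

theorem isHom_mainRule_body (hσ : σ ∈ S) {t : List ℕ}
    (hh : IsHom h σ.1 (Chase (auxDatabase S D A) (mainPart S)))
    (ht : (auxVars S k σ).map h = t.map Value.const) (haux : (freshName S + k, t) ∈ A) :
    IsHom (h ∘ origin S σ.2) (mainRule S k σ).1 (Chase (auxDatabase S D A) (mainPart S)) := by
  rw [mainRule_eq]
  refine List.forall_mem_cons.2 ⟨?_, ?_⟩
  · rw [map_valueOf_auxArgs hσ, ht]
    exact .base (a := (freshName S + k, t)) (List.mem_append_right _ haux)
  · refine (isHom_congr fun x hx => ?_).2 fun b hb => hh b (pAtoms_subset hb)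
    rw [Function.comp_apply,
      origin_of_lt (var_lt_freshVar hσ (Or.inl (conjVars_subset pAtoms_subset hx)))]

theorem skolem_comp_origin (hσ : σ ∈ S) {y : ℕ} (hy : y ∈ conjVars (mainHead S k σ)) :
    skolem k (mainRule S k σ) (h ∘ origin S σ.2) (origin S σ.2 y) =
      skolem k (mainRule S k σ) (h ∘ origin S σ.2) y := by
  rcases lt_freshVar_or_mem_auxArgs hσ hy with hlt | hya
  · rw [origin_of_lt hlt]
  · have hyb := origin_mem_bridge hσ hya
    rw [skolem, skolem, if_pos (mem_conjVars_mainRule_body.2 (Or.inl (var_mem_auxArgs hyb))),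
      if_pos (mem_conjVars_mainRule_body.2 (Or.inl hya)), Function.comp_apply,
      Function.comp_apply, origin_of_lt (bridge_lt_freshVar hσ hyb)]

theorem skolem_eq_of_isFrontier (hσ : σ ∈ S) {x : ℕ} (hx : IsFrontier σ x) :
    skolem k (mainRule S k σ) (h ∘ origin S σ.2) x = h x := by
  have hxm : x ∈ conjVars (mainRule S k σ).1 := mem_conjVars_mainRule_body.2
    ((IsFrontier.mem_pAtoms_or_mem_bridge hx).symm.imp_left var_mem_auxArgs)
  rw [skolem, if_pos hxm, Function.comp_apply, origin_of_lt (var_lt_freshVar hσ (Or.inl hx.1))]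

theorem satRule_chaseReduct (hA : ∀ a ∈ A, ∀ c ∈ a.2, c ∈ domain D S)
    (hsat : ∀ a, AuxStep S D A a → a ∈ A) (hσ : σ ∈ S) : SatRule (chaseReduct S D A) σ := by
  obtain ⟨k, hk⟩ := List.getElem?_of_mem hσ
  intro h hh
  rw [isHom_chaseReduct fun a ha => name_lt_freshName hσ (Or.inl ha)] at hh
  obtain ⟨t, ht, haux⟩ := exists_auxFact hA hsat hk hh
  have hhead : IsHom (skolem k (mainRule S k σ) (h ∘ origin S σ.2)) (mainHead S k σ)
      (Chase (auxDatabase S D A) (mainPart S)) := fun a ha =>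
    Chase.step (getElem?_mainPart.trans (congrArg _ hk)) (isHom_mainRule_body hσ hh ht haux) ha
  refine ⟨_, fun x hx => skolem_eq_of_isFrontier (k := k) hσ hx, ?_⟩
  rw [isHom_chaseReduct fun a ha => name_lt_freshName hσ (Or.inr ha), ← isHom_mainHead hσ]
  exact (isHom_congr fun y hy => skolem_comp_origin hσ hy).2 hhead

end SatRule

theorem cert_mainPart_of_cert (hA : ∀ a ∈ A, ∀ c ∈ a.2, c ∈ domain D S)
    (hsat : ∀ a, AuxStep S D A a → a ∈ A) {q : CQ} {c : List ℕ} (hc : c ∈ cert q D S) :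
    c ∈ cert (q.1, shiftAtoms S q.2) (auxDatabase S D A) (mainPart S) := by
  have hD : ∀ a ∈ D, (a.1, a.2.map Value.const) ∈ chaseReduct S D A := fun a ha =>
    .base (a := (shiftName S a.1, a.2)) (List.mem_append_left _ (List.mem_map.2 ⟨a, ha, rfl⟩))
  obtain ⟨h, hh, hq⟩ := hc _ ⟨hD, fun σ hσ => satRule_chaseReduct hA hsat hσ⟩
  exact mem_cert_of_mem_evalCQ_chase ⟨h, List.forall_mem_map.2 hh, hq⟩

end Completeness

/-! ### Saturation -/

/-- A derivation that no step of `P` extends by a new element. -/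
structure IsSaturation {α : Type*} (P : List α → α → Prop) (A : List α) : Prop where
  isDerivation : IsDerivation P A
  mem_of_step : ∀ a, P A a → a ∈ A

theorem IsDerivation.forall_mem {α : Type*} {P : List α → α → Prop} {Q : α → Prop}
    (h : ∀ A a, P A a → Q a) {A : List α} (hA : IsDerivation P A) : ∀ a ∈ A, Q a := by
  induction hA with
  | nil => simp
  | cons ha _ ih => exact List.forall_mem_cons.2 ⟨h _ _ ha, ih⟩

theorem IsDerivation.mono {α : Type*} {P Q : List α → α → Prop} (h : ∀ A a, P A a → Q A a)
    {A : List α} (hA : IsDerivation P A) : IsDerivation Q A := by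
  induction hA with
  | nil => exact .nil
  | cons ha _ ih => exact .cons (h _ _ ha) ih

theorem isDerivation_cons {α : Type*} {P : List α → α → Prop} {a : α} {A : List α} :
    IsDerivation P (a :: A) ↔ P A a ∧ IsDerivation P A :=
  ⟨fun h => by cases h with | cons ha hA => exact ⟨ha, hA⟩, fun h => .cons h.1 h.2⟩

theorem isDerivation_iff {α : Type*} {P : List α → α → Prop} {A : List α} : IsDerivation P A ↔
    ∀ i ∈ List.range A.length, ∀ a ∈ (A[i]?).toList, P (A.drop (i + 1)) a := by
  induction A with
  | nil => simp [IsDerivation.nil]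
  | cons b A ih =>
    rw [isDerivation_cons, ih, List.length_cons, List.range_succ_eq_map, List.forall_mem_cons]
    simp

theorem exists_isSaturation {α : Type*} (P : List α → α → Prop) (U : List α)
    (hU : ∀ A a, P A a → a ∈ U) : ∃ A, IsSaturation P A := by
  have hfin : {s : Set α | ∃ A, IsDerivation P A ∧ {a | a ∈ A} = s}.Finite := by
    refine (List.finite_toSet U).finite_subsets.subset ?_
    rintro _ ⟨A, hA, rfl⟩
    exact hA.forall_mem hU
  obtain ⟨_, ⟨A, hA, rfl⟩, hmax⟩ := hfin.exists_maximal ⟨_, [], .nil, rfl⟩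
  exact ⟨A, hA, fun a ha => hmax ⟨a :: A, .cons ha hA, rfl⟩
    (fun _ => List.mem_cons_of_mem a) List.mem_cons_self⟩

theorem exists_isSaturation_auxStep (S : Ontology) (D : Database) :
    ∃ A, IsSaturation (AuxStep S D) A :=
  exists_isSaturation _
    ((auxQueries S).flatMap fun e => (tuples (domain D S) e.2.1.length).map fun t => (e.1, t))
    fun _ _ ⟨_, hq, ht, _⟩ => List.mem_flatMap.2 ⟨_, hq, List.mem_map.2 ⟨_, ht, rfl⟩⟩

theorem IsSaturation.cert_mainPart_iff {S : Ontology} {D A : Database}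
    (hA : IsSaturation (AuxStep S D) A) {q : CQ} {c : List ℕ} :
    c ∈ cert (q.1, shiftAtoms S q.2) (auxDatabase S D A) (mainPart S) ↔ c ∈ cert q D S :=
  ⟨cert_of_cert_mainPart hA.isDerivation, cert_mainPart_of_cert
    (hA.isDerivation.forall_mem fun _ _ ⟨_, _, ht, _⟩ => (mem_tuples.1 ht).2) hA.mem_of_step⟩

/-! ### Primitive recursive functions and predicates -/

attribute [fun_prop] Primrec PrimrecPred Primrec.id Primrec.const Primrec.comp Primrec.pair
  Primrec.fst Primrec.snd Primrec.ite PrimrecPred.and PrimrecPred.or PrimrecPred.not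

section Toolbox

variable {α β γ δ : Type*} [Primcodable α] [Primcodable β] [Primcodable γ] [Primcodable δ]

@[fun_prop]
theorem primrec_fst {f : α → β × γ} (hf : Primrec f) : Primrec fun a => (f a).1 :=
  Primrec.fst.comp hf

@[fun_prop]
theorem primrec_snd {f : α → β × γ} (hf : Primrec f) : Primrec fun a => (f a).2 :=
  Primrec.snd.comp hf

@[fun_prop]
theorem primrec_add {f g : α → ℕ} (hf : Primrec f) (hg : Primrec g) :
    Primrec fun a => f a + g a :=
  Primrec.nat_add.comp hf hg

@[fun_prop]
theorem primrec_natPair {f g : α → ℕ} (hf : Primrec f) (hg : Primrec g) :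
    Primrec fun a => Nat.pair (f a) (g a) :=
  Primrec₂.natPair.comp hf hg

@[fun_prop]
theorem primrec_some {f : α → β} (hf : Primrec f) : Primrec fun a => some (f a) :=
  Primrec.option_some.comp hf

@[fun_prop]
theorem primrec_inl {f : α → β} (hf : Primrec f) : Primrec fun a => (Sum.inl (f a) : β ⊕ γ) :=
  Primrec.sumInl.comp hf

@[fun_prop]
theorem primrec_inr {f : α → γ} (hf : Primrec f) : Primrec fun a => (Sum.inr (f a) : β ⊕ γ) :=
  Primrec.sumInr.comp hf

@[fun_prop]
theorem primrec_sumElim {f : α → β ⊕ γ} {g : α → β → δ} {h : α → γ → δ} (hf : Primrec f)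
    (hg : Primrec fun x : α × β => g x.1 x.2) (hh : Primrec fun x : α × γ => h x.1 x.2) :
    Primrec fun a => Sum.elim (g a) (h a) (f a) :=
  (Primrec.sumCasesOn hf hg.to₂ hh.to₂).of_eq fun a => by cases f a <;> rfl

@[fun_prop]
theorem primrec_getLeft? {f : α → β ⊕ γ} (hf : Primrec f) : Primrec fun a => (f a).getLeft? :=
  (primrec_sumElim (g := fun _ => some) (h := fun _ _ => none) hf (by fun_prop)
    (by fun_prop)).of_eq fun a => by cases f a <;> rfl

@[fun_prop]
theorem primrec_getRight? {f : α → β ⊕ γ} (hf : Primrec f) : Primrec fun a => (f a).getRight? :=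
  (primrec_sumElim (g := fun _ _ => none) (h := fun _ => some) hf (by fun_prop)
    (by fun_prop)).of_eq fun a => by cases f a <;> rfl

@[fun_prop]
theorem primrecPred_imp {p q : α → Prop} (hp : PrimrecPred p) (hq : PrimrecPred q) :
    PrimrecPred fun a => p a → q a :=
  (hp.not.or hq).of_eq fun _ => imp_iff_not_or.symm

@[fun_prop]
theorem primrecPred_eq {f g : α → β} (hf : Primrec f) (hg : Primrec g) :
    PrimrecPred fun a => f a = g a :=
  Primrec.eq.comp hf hg

@[fun_prop]
theorem primrecPred_lt {f g : α → ℕ} (hf : Primrec f) (hg : Primrec g) :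
    PrimrecPred fun a => f a < g a :=
  Primrec.nat_lt.comp hf hg

@[fun_prop]
theorem primrec_length {f : α → List β} (hf : Primrec f) : Primrec fun a => (f a).length :=
  Primrec.list_length.comp hf

@[fun_prop]
theorem primrec_cons {f : α → β} {l : α → List β} (hf : Primrec f) (hl : Primrec l) :
    Primrec fun a => f a :: l a :=
  Primrec.list_cons.comp hf hl

@[fun_prop]
theorem primrec_append {f g : α → List β} (hf : Primrec f) (hg : Primrec g) :
    Primrec fun a => f a ++ g a :=
  Primrec.list_append.comp hf hg

@[fun_prop]
theorem primrec_take {n : α → ℕ} {l : α → List β} (hn : Primrec n) (hl : Primrec l) :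
    Primrec fun a => (l a).take (n a) :=
  Primrec.list_take.comp hn hl

@[fun_prop]
theorem primrec_drop {n : α → ℕ} {l : α → List β} (hn : Primrec n) (hl : Primrec l) :
    Primrec fun a => (l a).drop (n a) :=
  Primrec.list_drop.comp hn hl

@[fun_prop]
theorem primrec_getElem? {l : α → List β} {n : α → ℕ} (hl : Primrec l) (hn : Primrec n) :
    Primrec fun a => (l a)[n a]? :=
  Primrec.list_getElem?.comp hl hn

@[fun_prop]
theorem primrec_optionToList {f : α → Option β} (hf : Primrec f) :
    Primrec fun a => (f a).toList :=
  Primrec.optionToList.comp hf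

@[fun_prop]
theorem primrec_range {n : α → ℕ} (hn : Primrec n) : Primrec fun a => List.range (n a) :=
  Primrec.list_range.comp hn

@[fun_prop]
theorem primrec_map {l : α → List β} {g : α → β → γ} (hl : Primrec l)
    (hg : Primrec fun x : α × β => g x.1 x.2) : Primrec fun a => (l a).map (g a) :=
  Primrec.list_map hl hg.to₂

@[fun_prop]
theorem primrec_flatMap {l : α → List β} {g : α → β → List γ} (hl : Primrec l)
    (hg : Primrec fun x : α × β => g x.1 x.2) : Primrec fun a => (l a).flatMap (g a) :=
  Primrec.list_flatMap hl hg.to₂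

@[fun_prop]
theorem primrec_filterMap {l : α → List β} {g : α → β → Option γ} (hl : Primrec l)
    (hg : Primrec fun x : α × β => g x.1 x.2) : Primrec fun a => (l a).filterMap (g a) :=
  Primrec.listFilterMap hl hg.to₂

@[fun_prop]
theorem primrec_filter {l : α → List β} {p : α → β → Prop} [∀ a, DecidablePred (p a)]
    (hl : Primrec l) (hp : PrimrecPred fun x : α × β => p x.1 x.2) :
    Primrec fun a => (l a).filter fun b => p a b :=
  (PrimrecRel.listFilter (R := fun b a => p a b)
    (hp.comp (Primrec.snd.pair Primrec.fst))).comp hl Primrec.id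

@[fun_prop]
theorem primrecPred_ball {l : α → List β} {p : α → β → Prop} (hl : Primrec l)
    (hp : PrimrecPred fun x : α × β => p x.1 x.2) : PrimrecPred fun a => ∀ b ∈ l a, p a b :=
  (PrimrecRel.forall_mem_list (R := fun b a => p a b)
    (hp.comp (Primrec.snd.pair Primrec.fst))).comp hl Primrec.id

@[fun_prop]
theorem primrecPred_bex {l : α → List β} {p : α → β → Prop} (hl : Primrec l)
    (hp : PrimrecPred fun x : α × β => p x.1 x.2) : PrimrecPred fun a => ∃ b ∈ l a, p a b :=
  (PrimrecRel.exists_mem_list (R := fun b a => p a b)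
    (hp.comp (Primrec.snd.pair Primrec.fst))).comp hl Primrec.id

@[fun_prop]
theorem primrecPred_mem {f : α → β} {l : α → List β} (hf : Primrec f) (hl : Primrec l) :
    PrimrecPred fun a => f a ∈ l a :=
  (primrecPred_bex (p := fun a b => b = f a) hl (by fun_prop)).of_eq fun a => by simp

@[fun_prop]
theorem primrec_foldr_max {l : α → List ℕ} (hl : Primrec l) :
    Primrec fun a => (l a).foldr max 0 :=
  Primrec.list_foldr hl (Primrec.const 0) (Primrec.nat_max.comp₂
    (Primrec.fst.comp₂ Primrec₂.right) (Primrec.snd.comp₂ Primrec₂.right))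

@[fun_prop]
theorem primrec_mapIdx {l : α → List β} {g : α → ℕ → β → γ} (hl : Primrec l)
    (hg : Primrec fun x : α × ℕ × β => g x.1 x.2.1 x.2.2) :
    Primrec fun a => (l a).mapIdx (g a) := by
  have hstep : Primrec₂ fun (a : α) (x : List γ × β) => x.1 ++ [g a x.1.length x.2] :=
    Primrec.list_concat.comp (by fun_prop) (hg.comp (g := fun y : α × List γ × β =>
      (y.1, y.2.1.length, y.2.2)) (by fun_prop))
  refine (Primrec.list_foldl hl (Primrec.const []) hstep).of_eq fun a => ?_
  induction l a using List.reverseRecOn with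
  | nil => rfl
  | append_singleton l b ih => simp [List.foldl_append, ih]

@[fun_prop]
theorem primrec_dedup [DecidableEq β] {l : α → List β} (hl : Primrec l) :
    Primrec fun a => (l a).dedup := by
  have hstep : Primrec fun y : α × β × List β =>
      if y.2.1 ∈ y.2.2 then y.2.2 else y.2.1 :: y.2.2 := by fun_prop
  refine (Primrec.list_foldr hl (Primrec.const []) hstep.to₂).of_eq fun a => ?_
  induction l a with
  | nil => rfl
  | cons b l ih =>
    rw [List.foldr_cons, ih]
    by_cases hb : b ∈ l
    · simp [hb, List.dedup_cons_of_mem]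
    · simp [hb, List.dedup_cons_of_notMem]

@[fun_prop]
theorem primrec_tuples {β : Type} [Primcodable β] {U : α → List β} {n : α → ℕ} (hU : Primrec U)
    (hn : Primrec n) : Primrec fun a => tuples (U a) (n a) := by
  have hstep : Primrec fun y : α × ℕ × List (List β) =>
      y.2.2.flatMap fun t => (U y.1).map fun u => u :: t := by fun_prop
  refine (Primrec.nat_rec' hn (Primrec.const [[]]) hstep.to₂).of_eq fun a => ?_
  induction n a with
  | zero => rfl
  | succ n ih => exact congrArg (List.flatMap _) ih

theorem primrecPred_isDerivation {P : α → List β → β → Prop} {A : α → List β} (hA : Primrec A)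
    (hP : PrimrecPred fun x : α × List β × β => P x.1 x.2.1 x.2.2) :
    PrimrecPred fun a => IsDerivation (P a) (A a) := by
  simp only [isDerivation_iff]
  refine primrecPred_ball (by fun_prop) (primrecPred_ball (by fun_prop) ?_)
  exact hP.comp (f := fun y : (α × ℕ) × β => (y.1.1, (A y.1.1).drop (y.1.2 + 1), y.2))
    (by fun_prop)

theorem primrecPred_isSaturation {P : α → List β → β → Prop} {U A : α → List β} (hU : Primrec U)
    (hA : Primrec A) (hP : PrimrecPred fun x : α × List β × β => P x.1 x.2.1 x.2.2)
    (hPU : ∀ a A b, P a A b → b ∈ U a) : PrimrecPred fun a => IsSaturation (P a) (A a) := by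
  have hstep : PrimrecPred fun y : α × β => P y.1 (A y.1) y.2 :=
    hP.comp (f := fun y : α × β => (y.1, A y.1, y.2)) (by fun_prop)
  have hmem : PrimrecPred fun a => ∀ b ∈ U a, P a (A a) b → b ∈ A a :=
    primrecPred_ball hU (primrecPred_imp hstep (by fun_prop))
  refine ((primrecPred_isDerivation hA hP).and hmem).of_eq fun a => ?_
  exact ⟨fun h => ⟨h.1, fun b hb => h.2 b (hPU _ _ _ hb) hb⟩,
    fun h => ⟨h.isDerivation, fun b _ => h.mem_of_step b⟩⟩

end Toolbox

/-! ### Certificates -/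

section Certificates

variable {α β γ : Type*} [Primcodable α] [Primcodable β] [Primcodable γ]

theorem exists_partrec_search {R : α → β → Prop} (hR : ComputablePred fun x : α × β => R x.1 x.2) :
    ∃ s : α →. β, Partrec s ∧ (∀ a b, b ∈ s a → R a b) ∧ ∀ a, (∃ b, R a b) → (s a).Dom := by
  classical
  let candidate : α → ℕ → Option β := fun a n =>
    (Encodable.decode n : Option β).bind (Option.guard fun b => R a b)
  have hguard : Computable fun x : (α × ℕ) × β => Option.guard (fun b => R x.1.1 b) x.2 := by
    refine (Computable.cond (hR.decide.comp (g := fun x : (α × ℕ) × β => (x.1.1, x.2))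
      ((Computable.fst.comp Computable.fst).pair Computable.snd))
      (Computable.option_some.comp Computable.snd) (Computable.const none)).of_eq fun x => ?_
    by_cases h : R x.1.1 x.2 <;> simp [Option.guard, h]
  have hcandidate : Computable₂ candidate :=
    Computable.option_bind (Computable.decode.comp Computable.snd) hguard
  refine ⟨fun a => Nat.rfindOpt (candidate a), Partrec.rfindOpt hcandidate, fun a b hb => ?_,
    fun a ⟨b, hb⟩ => Nat.rfindOpt_dom.2 ⟨Encodable.encode b, b, ?_⟩⟩
  · obtain ⟨n, hn⟩ := Nat.rfindOpt_spec hb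
    obtain ⟨b', -, hb'⟩ := Option.bind_eq_some_iff.1 hn
    obtain ⟨rfl, hR'⟩ := Option.guard_eq_some_iff.1 hb'
    simpa using hR'
  · simp [candidate, Option.guard, hb]

theorem computable_of_certificate {R : α → β → Prop}
    (hR : ComputablePred fun x : α × β => R x.1 x.2) {f : α → γ} {g : α → β → γ}
    (hg : Computable₂ g) (hex : ∀ a, ∃ b, R a b) (h : ∀ a b, R a b → g a b = f a) :
    Computable f := by
  obtain ⟨s, hs, hsR, hdom⟩ := exists_partrec_search hR
  refine Partrec.of_eq_tot (hs.map hg) fun a => ?_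
  obtain ⟨b, hb⟩ := Part.dom_iff_mem.1 (hdom a (hex a))
  rw [← h a b (hsR a b hb)]
  exact Part.mem_map _ hb

end Certificates

/-! ### Computing the affected positions -/

/-- The positions of the conjunction `A` at which the term `t` occurs, as triples. -/
def positions (A : Conj) (t : Term) : List (ℕ × ℕ × ℕ) :=
  A.flatMap fun a => ((List.range a.2.length).filter fun i => a.2[i]? = some t).map
    fun i => (a.1, a.2.length, i)

theorem mem_positions {A : Conj} {x : ℕ} {π : Position} :
    (π.name, π.arity, π.index) ∈ positions A (Term.var x) ↔ OccursAt x A π := by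
  simp only [positions, List.mem_flatMap, List.mem_map, List.mem_filter, List.mem_range,
    decide_eq_true_eq, Prod.mk.injEq, OccursAt]
  refine exists_congr fun a => and_congr_right fun _ => ⟨?_, ?_⟩
  · rintro ⟨i, ⟨-, hi⟩, hname, harity, rfl⟩
    exact ⟨hname, harity, hi⟩
  · rintro ⟨hname, harity, hi⟩
    exact ⟨_, ⟨(List.getElem?_eq_some_iff.1 hi).1, hi⟩, hname, harity, rfl⟩

theorem mem_conjVars_of_mem_positions {A : Conj} {x : ℕ} {π : ℕ × ℕ × ℕ}
    (h : π ∈ positions A (Term.var x)) : x ∈ conjVars A :=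
  mem_conjVars_iff_occursAt.2 ⟨⟨π.1, π.2.1, π.2.2⟩, mem_positions.1 h⟩

theorem forall_mem_positions {A : Conj} {x : ℕ} {P : ℕ × ℕ × ℕ → Prop} :
    (∀ π ∈ positions A (Term.var x), P π) ↔
      ∀ π : Position, OccursAt x A π → P (π.name, π.arity, π.index) :=
  ⟨fun h _ hπ => h _ (mem_positions.2 hπ), fun h π hπ => h ⟨π.1, π.2.1, π.2.2⟩ (mem_positions.1 hπ)⟩

/-- The existential variables of an ontology, each with its rule. -/
def exVars (S : Ontology) : List (Rule × ℕ) :=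
  S.flatMap fun ρ => ((conjVars ρ.2).filter fun z => z ∉ conjVars ρ.1).map fun z => (ρ, z)

theorem mem_exVars {S : Ontology} {ρ : Rule} {z : ℕ} :
    (ρ, z) ∈ exVars S ↔ ρ ∈ S ∧ IsExVar ρ z := by
  simp [exVars, IsExVar]

theorem Affected.mem_exVars {S : Ontology} {ρ : Rule} {z : ℕ} {π : Position}
    (h : Affected S ρ z π) : (ρ, z) ∈ exVars S := by
  induction h with
  | intro hρ hz _ => exact DyadicTGD.mem_exVars.2 ⟨hρ, hz⟩
  | propagate _ _ _ hx _ _ ih =>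
    obtain ⟨π₀, hπ₀⟩ := mem_conjVars_iff_occursAt.1 hx.1
    exact ih π₀ hπ₀

/-- An existential variable together with a position, as a triple. -/
abbrev AffItem := (Rule × ℕ) × (ℕ × ℕ × ℕ)

/-- The position is affected by the existential variable, given that this holds for `L`. -/
def AffStep (S : Ontology) (L : List AffItem) (e : AffItem) : Prop :=
  e.1 ∈ exVars S ∧ (e.2 ∈ positions e.1.1.2 (Term.var e.1.2) ∨
    ∃ σ ∈ S, ∃ x ∈ conjVars σ.1, e.2 ∈ positions σ.2 (Term.var x) ∧
      ∀ π ∈ positions σ.1 (Term.var x), (e.1, π) ∈ L)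

/-- The existential variables, each with every position at which a variable occurs in a head. -/
def affCandidates (S : Ontology) : List AffItem :=
  (exVars S).flatMap fun e => S.flatMap fun σ => (conjVars σ.2).flatMap fun x =>
    (positions σ.2 (Term.var x)).map fun π => (e, π)

section Affected

variable {S : Ontology} {L : List AffItem} {ρ : Rule} {z : ℕ} {π : Position}

theorem AffStep.mem_affCandidates {e : AffItem} (h : AffStep S L e) : e ∈ affCandidates S := by
  obtain ⟨he, hstep⟩ := h
  obtain ⟨σ, hσ, x, hx⟩ : ∃ σ ∈ S, ∃ x, e.2 ∈ positions σ.2 (Term.var x) := by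
    rcases hstep with hπ | ⟨σ, hσ, x, -, hπ, -⟩
    · exact ⟨_, (mem_exVars.1 he).1, _, hπ⟩
    · exact ⟨σ, hσ, x, hπ⟩
  simp only [affCandidates, List.mem_flatMap, List.mem_map]
  exact ⟨_, he, σ, hσ, x, mem_conjVars_of_mem_positions hx, _, hx, rfl⟩

theorem affected_of_mem_isDerivation (hL : IsDerivation (AffStep S) L) :
    ∀ e ∈ L, Affected S e.1.1 e.1.2 ⟨e.2.1, e.2.2.1, e.2.2.2⟩ := by
  induction hL with
  | nil => simp
  | cons he _ ih =>
    refine List.forall_mem_cons.2 ⟨?_, ih⟩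
    obtain ⟨hex, hπ | ⟨σ, hσ, x, hx, hπ, hb⟩⟩ := he
    · have hex := mem_exVars.1 hex
      exact .intro hex.1 hex.2 (mem_positions.1 hπ)
    · exact .propagate σ x hσ ⟨hx, mem_conjVars_of_mem_positions hπ⟩ (mem_positions.1 hπ)
        fun π' hπ' => ih _ (hb _ (mem_positions.2 hπ'))

theorem Affected.mem_of_isSaturation (h : Affected S ρ z π) (hL : IsSaturation (AffStep S) L) :
    ((ρ, z), (π.name, π.arity, π.index)) ∈ L := by
  have hex := h.mem_exVars
  induction h with
  | intro _ _ hπ => exact hL.mem_of_step _ ⟨hex, Or.inl (mem_positions.2 hπ)⟩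
  | propagate σ x hσ hx hπ _ ih =>
    exact hL.mem_of_step _
      ⟨hex, Or.inr ⟨σ, hσ, x, hx.1, mem_positions.2 hπ, forall_mem_positions.2 ih⟩⟩

theorem mem_iff_affected (hL : IsSaturation (AffStep S) L) :
    ((ρ, z), (π.name, π.arity, π.index)) ∈ L ↔ Affected S ρ z π :=
  ⟨affected_of_mem_isDerivation hL.isDerivation _, fun h => h.mem_of_isSaturation hL⟩

end Affected

/-! ### Computing the problematic atoms -/

/-- `Harmful`, in terms of a list of the affected positions. -/
def HarmfulIn (S : Ontology) (L : List AffItem) (σ : Rule) (x : ℕ) : Prop :=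
  x ∈ conjVars σ.1 ∧ ∃ e ∈ exVars S, ∀ π ∈ positions σ.1 (Term.var x), (e, π) ∈ L

/-- A rule together with an atom. -/
abbrev ProbItem := Rule × Atom

/-- The atom is problematic for the rule, given that this holds for `M`, where `L` lists the
affected positions. -/
def ProbStep (S : Ontology) (L : List AffItem) (M : List ProbItem) (e : ProbItem) : Prop :=
  (e.1 ∈ S ∧ e.2 ∈ e.1.1) ∧ ∃ x ∈ termVars e.2.2, HarmfulIn S L e.1 x ∧
    (x ∈ conjVars e.1.2 ∨ ∃ b ∈ e.1.1, (e.1, b) ∈ M ∧ x ∈ termVars b.2)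

/-- The rules, each with every atom of its body. -/
def bodyItems (S : Ontology) : List ProbItem := S.flatMap fun σ => σ.1.map fun a => (σ, a)

theorem mem_bodyItems {S : Ontology} {e : ProbItem} :
    e ∈ bodyItems S ↔ e.1 ∈ S ∧ e.2 ∈ e.1.1 := by
  obtain ⟨σ, a⟩ := e
  simp [bodyItems]

theorem Problematic.mem_body {S : Ontology} {σ : Rule} {a : Atom} (h : Problematic S σ a) :
    a ∈ σ.1 := by
  cases h <;> assumption

section Problematic

variable {S : Ontology} {L : List AffItem} {M : List ProbItem} {σ : Rule} {a : Atom}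

theorem harmfulIn_iff (hL : IsSaturation (AffStep S) L) {x : ℕ} :
    HarmfulIn S L σ x ↔ Harmful S σ x := by
  refine and_congr_right fun hx => ?_
  rw [← Set.nonempty_iff_ne_empty]
  constructor
  · rintro ⟨e, -, he⟩
    exact ⟨e, fun π hπ => (mem_iff_affected hL).1 (he _ (mem_positions.2 hπ))⟩
  · rintro ⟨e, he⟩
    obtain ⟨π, hπ⟩ := mem_conjVars_iff_occursAt.1 hx
    exact ⟨e, Affected.mem_exVars (he π hπ),
      forall_mem_positions.2 fun π hπ => (mem_iff_affected hL).2 (he π hπ)⟩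

theorem problematic_of_mem_isDerivation (hL : IsSaturation (AffStep S) L)
    (hM : IsDerivation (ProbStep S L) M) : ∀ e ∈ M, Problematic S e.1 e.2 := by
  induction hM with
  | nil => simp
  | cons he _ ih =>
    refine List.forall_mem_cons.2 ⟨?_, ih⟩
    obtain ⟨⟨-, ha⟩, x, hx, hh, hfr | ⟨b, -, hbM, hxb⟩⟩ := he
    · exact .dangerous _ x ha hx ⟨(harmfulIn_iff hL).1 hh, hh.1, hfr⟩
    · exact .connected _ b x ha (ih _ hbM) hx hxb ((harmfulIn_iff hL).1 hh)

theorem Problematic.mem_of_isSaturation (h : Problematic S σ a) (hL : IsSaturation (AffStep S) L)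
    (hM : IsSaturation (ProbStep S L) M) (hσ : σ ∈ S) : (σ, a) ∈ M := by
  induction h with
  | dangerous a x ha hx hd =>
    exact hM.mem_of_step _ ⟨⟨hσ, ha⟩, x, hx, (harmfulIn_iff hL).2 hd.1, Or.inl hd.2.2⟩
  | connected a b x ha hb hxa hxb hx ih =>
    exact hM.mem_of_step _
      ⟨⟨hσ, ha⟩, x, hxa, (harmfulIn_iff hL).2 hx, Or.inr ⟨b, hb.mem_body, ih, hxb⟩⟩

theorem mem_iff_problematic (hL : IsSaturation (AffStep S) L)
    (hM : IsSaturation (ProbStep S L) M) (hσ : σ ∈ S) : (σ, a) ∈ M ↔ Problematic S σ a :=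
  ⟨problematic_of_mem_isDerivation hL hM.isDerivation _,
    fun h => h.mem_of_isSaturation hL hM hσ⟩

end Problematic

section Primrec

variable {α : Type*} [Primcodable α] {S : α → Ontology} {L : α → List AffItem}
  {M : α → List ProbItem} {σ : α → Rule} {A : α → Conj}

@[fun_prop]
theorem primrec_termVars {f : α → List Term} (hf : Primrec f) :
    Primrec fun a => termVars (f a) := by
  unfold termVars
  fun_prop

@[fun_prop]
theorem primrec_conjVars (hA : Primrec A) : Primrec fun a => conjVars (A a) := by
  unfold conjVars
  fun_prop

@[fun_prop]
theorem primrec_positions {t : α → Term} (hA : Primrec A) (ht : Primrec t) :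
    Primrec fun a => positions (A a) (t a) := by
  unfold positions
  fun_prop

@[fun_prop]
theorem primrec_exVars (hS : Primrec S) : Primrec fun a => exVars (S a) := by
  unfold exVars
  fun_prop

@[fun_prop]
theorem primrecPred_affStep {e : α → AffItem} (hS : Primrec S) (hL : Primrec L) (he : Primrec e) :
    PrimrecPred fun a => AffStep (S a) (L a) (e a) := by
  unfold AffStep
  fun_prop

@[fun_prop]
theorem primrec_affCandidates (hS : Primrec S) : Primrec fun a => affCandidates (S a) := by
  unfold affCandidates
  fun_prop

@[fun_prop]
theorem primrecPred_isSaturation_affStep (hS : Primrec S) (hL : Primrec L) :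
    PrimrecPred fun a => IsSaturation (AffStep (S a)) (L a) :=
  primrecPred_isSaturation (U := fun a => affCandidates (S a)) (by fun_prop) hL (by fun_prop)
    fun _ _ _ h => h.mem_affCandidates

@[fun_prop]
theorem primrecPred_harmfulIn {x : α → ℕ} (hS : Primrec S) (hL : Primrec L) (hσ : Primrec σ)
    (hx : Primrec x) : PrimrecPred fun a => HarmfulIn (S a) (L a) (σ a) (x a) := by
  unfold HarmfulIn
  fun_prop

@[fun_prop]
theorem primrecPred_probStep {e : α → ProbItem} (hS : Primrec S) (hL : Primrec L)
    (hM : Primrec M) (he : Primrec e) :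
    PrimrecPred fun a => ProbStep (S a) (L a) (M a) (e a) := by
  unfold ProbStep
  fun_prop

@[fun_prop]
theorem primrec_bodyItems (hS : Primrec S) : Primrec fun a => bodyItems (S a) := by
  unfold bodyItems
  fun_prop

@[fun_prop]
theorem primrecPred_isSaturation_probStep (hS : Primrec S) (hL : Primrec L) (hM : Primrec M) :
    PrimrecPred fun a => IsSaturation (ProbStep (S a) (L a)) (M a) :=
  primrecPred_isSaturation (U := fun a => bodyItems (S a)) (by fun_prop) hM (by fun_prop)
    fun _ _ _ h => mem_bodyItems.2 h.1

end Primrec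

/-! ### Computing the main part -/

/-- The problematic atoms, the safe atoms and the bridge variables of a rule. -/
abbrev SplitData := Conj × Conj × List ℕ

/-- The main rule of `σ`, the name of `Aux_σ` and the query for it, in terms of the split of the
body of `σ`. -/
def ruleOfSplit (S : Ontology) (k : ℕ) (σ : Rule) (d : SplitData) : Rule × ℕ × CQ :=
  let H := splitHead d.2.2 (copyVar S k) σ.2
  let R := (H.flatMap Prod.snd).filter fun p => p.1 ≠ p.2
  (((freshName S + k, d.2.2.map Term.var ++ R.map Prod.snd) :: d.1,
      H.map fun a => (a.1, a.2.map Prod.snd)),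
    freshName S + k, d.2.2 ++ termVars (R.map Prod.fst), d.2.1)

theorem ruleOfSplit_eq (S : Ontology) (k : ℕ) (σ : Rule) :
    ruleOfSplit S k σ (pAtoms S σ, sAtoms S σ, bridge S σ) =
      (mainRule S k σ, freshName S + k, auxQuery S k σ) := rfl

open Classical in
/-- The split of the body of `σ`, in terms of a list `L` of the affected positions and a list `M`
of the problematic atoms. -/
noncomputable def splitIn (S : Ontology) (L : List AffItem) (M : List ProbItem) (σ : Rule) :
    SplitData :=
  let p := σ.1.filter fun a => (σ, a) ∈ M
  let s := σ.1.filter fun a => (σ, a) ∉ M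
  (p, s, (conjVars s).dedup.filter fun x =>
    x ∈ conjVars p ∨ (¬ HarmfulIn S L σ x ∧ x ∈ conjVars σ.1 ∧ x ∈ conjVars σ.2))

theorem splitIn_eq {S : Ontology} {L : List AffItem} {M : List ProbItem}
    (hL : IsSaturation (AffStep S) L) (hM : IsSaturation (ProbStep S L) M) {σ : Rule}
    (hσ : σ ∈ S) : splitIn S L M σ = (pAtoms S σ, sAtoms S σ, bridge S σ) := by
  have hp : (splitIn S L M σ).1 = pAtoms S σ :=
    List.filter_congr fun a _ => decide_eq_decide.2 (mem_iff_problematic hL hM hσ)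
  have hs : (splitIn S L M σ).2.1 = sAtoms S σ :=
    List.filter_congr fun a _ => decide_eq_decide.2 (not_congr (mem_iff_problematic hL hM hσ))
  have hharmless : ∀ x, (¬ HarmfulIn S L σ x ∧ IsFrontier σ x) ↔
      (Harmless S σ x ∧ IsFrontier σ x) := fun x => and_congr_left fun hx => by
    rw [harmfulIn_iff hL]
    exact ⟨(harmless_or_harmful hx.1).resolve_right, fun h h' => h'.2 h.2⟩
  refine Prod.ext hp (Prod.ext hs ?_)
  change List.filter _ (conjVars (splitIn S L M σ).2.1).dedup = List.filter _ _
  rw [hs]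
  refine List.filter_congr fun x _ => decide_eq_decide.2 ?_
  change x ∈ conjVars (splitIn S L M σ).1 ∨ _ ↔ _
  rw [hp]
  exact or_congr_right (hharmless x)

/-- An argument of a head, paired with its new name `y` if it is a variable of both `B` and `V`. -/
def splitArg (B V : List ℕ) (y : ℕ) (t : Term) : Term × Term :=
  Sum.elim (fun c => (Term.const c, Term.const c))
    (fun x => if x ∈ B ∧ x ∈ V then (Term.var x, Term.var y) else (Term.var x, Term.var x)) t

theorem splitHead_eq (B : List ℕ) (new : ℕ → ℕ → ℕ) (H : Conj) :
    splitHead B new H = H.mapIdx fun i a => (a.1, a.2.mapIdx fun j t =>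
      splitArg B (conjVars (H.take i) ++ termVars (a.2.take j)) (new i j) t) := by
  unfold splitHead
  congr! 7 with i a j t
  rcases t with c | x
  · rfl
  · simp [splitArg]

section Primrec

variable {α : Type*} [Primcodable α] {S : α → Ontology} {L : α → List AffItem}
  {M : α → List ProbItem} {σ : α → Rule} {k : α → ℕ} {B V : α → List ℕ}

@[fun_prop]
theorem primrec_freshName (hS : Primrec S) : Primrec fun a => freshName (S a) := by
  unfold freshName
  fun_prop

@[fun_prop]
theorem primrec_freshVar (hS : Primrec S) : Primrec fun a => freshVar (S a) := by
  unfold freshVar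
  fun_prop

@[fun_prop]
theorem primrec_copyVar {i j : α → ℕ} (hS : Primrec S) (hk : Primrec k) (hi : Primrec i)
    (hj : Primrec j) : Primrec fun a => copyVar (S a) (k a) (i a) (j a) := by
  unfold copyVar
  fun_prop

@[fun_prop]
theorem primrec_splitIn (hS : Primrec S) (hL : Primrec L) (hM : Primrec M) (hσ : Primrec σ) :
    Primrec fun a => splitIn (S a) (L a) (M a) (σ a) := by
  unfold splitIn
  fun_prop

@[fun_prop]
theorem primrec_splitArg {y : α → ℕ} {t : α → Term} (hB : Primrec B) (hV : Primrec V)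
    (hy : Primrec y) (ht : Primrec t) :
    Primrec fun a => splitArg (B a) (V a) (y a) (t a) := by
  unfold splitArg
  fun_prop

theorem primrec_splitHead {new : α → ℕ → ℕ → ℕ} {H : α → Conj} (hB : Primrec B)
    (hnew : Primrec fun x : α × ℕ × ℕ => new x.1 x.2.1 x.2.2) (hH : Primrec H) :
    Primrec fun a => splitHead (B a) (new a) (H a) := by
  simp only [splitHead_eq]
  refine primrec_mapIdx hH (.pair (by fun_prop) (primrec_mapIdx (by fun_prop) ?_))
  exact primrec_splitArg (by fun_prop) (by fun_prop)
    (hnew.comp (g := fun x : (α × ℕ × Atom) × ℕ × Term => (x.1.1, x.1.2.1, x.2.1))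
      (by fun_prop)) (by fun_prop)

@[fun_prop]
theorem primrec_ruleOfSplit {d : α → SplitData} (hS : Primrec S) (hk : Primrec k)
    (hσ : Primrec σ) (hd : Primrec d) :
    Primrec fun a => ruleOfSplit (S a) (k a) (σ a) (d a) := by
  have hH : Primrec fun a => splitHead (d a).2.2 (copyVar (S a) (k a)) (σ a).2 :=
    primrec_splitHead (by fun_prop) (by fun_prop) (by fun_prop)
  unfold ruleOfSplit
  fun_prop

end Primrec

theorem computable_mainRules : Computable fun S : Ontology =>
    S.mapIdx fun k σ => (mainRule S k σ, freshName S + k, auxQuery S k σ) := by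
  let R : Ontology → List AffItem × List ProbItem → Prop := fun S c =>
    IsSaturation (AffStep S) c.1 ∧ IsSaturation (ProbStep S c.1) c.2
  let rules : Ontology → List AffItem × List ProbItem → List (Rule × ℕ × CQ) := fun S c =>
    S.mapIdx fun k σ => ruleOfSplit S k σ (splitIn S c.1 c.2 σ)
  have hR : PrimrecPred fun x : Ontology × List AffItem × List ProbItem => R x.1 x.2 := by
    fun_prop
  have hrules : Primrec fun x : Ontology × List AffItem × List ProbItem => rules x.1 x.2 := by
    fun_prop
  refine computable_of_certificate hR.computablePred hrules.to_comp (fun S => ?_)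
    fun S ⟨L, M⟩ ⟨hL, hM⟩ => ?_
  · obtain ⟨L, hL⟩ := exists_isSaturation (AffStep S) (affCandidates S)
      fun _ _ h => h.mem_affCandidates
    obtain ⟨M, hM⟩ := exists_isSaturation (ProbStep S L) (bodyItems S)
      fun _ _ h => mem_bodyItems.2 h.1
    exact ⟨(L, M), hL, hM⟩
  · refine List.ext_getElem (by simp [rules]) fun i _ _ => ?_
    simp only [rules, List.getElem_mapIdx]
    rw [splitIn_eq hL hM (List.getElem_mem _), ruleOfSplit_eq]

theorem computable_mainPart_auxQueries :
    Computable fun S : Ontology => (mainPart S, auxQueries S) := by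
  have hproj : Primrec fun l : List (Rule × ℕ × CQ) => (l.map Prod.fst, l.map Prod.snd) := by
    fun_prop
  refine (hproj.to_comp.comp computable_mainRules).of_eq fun S => ?_
  refine Prod.ext ?_ ?_ <;> exact List.ext_getElem (by simp [mainPart, auxQueries])
    fun i _ _ => by simp [mainPart, auxQueries]

/-! ### Searching for a saturation -/

theorem exists_primrec_approximation {α β : Type} [Primcodable α] [Primcodable β] {f : α →. β}
    (hf : Partrec f) : ∃ F : ℕ → α → Option β, Primrec₂ F ∧
      (∀ k a b, F k a = some b → b ∈ f a) ∧
      ∀ a, ∀ b ∈ f a, ∀ᶠ k in Filter.atTop, F k a = some b := by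
  obtain ⟨c, hc⟩ := Nat.Partrec.Code.exists_code.1 hf
  have hmem : ∀ a n, n ∈ c.eval (Encodable.encode a) ↔ ∃ b ∈ f a, Encodable.encode b = n := by
    intro a n
    rw [hc]
    simp
  refine ⟨fun k a => (c.evaln k (Encodable.encode a)).bind Encodable.decode, ?_, ?_, ?_⟩
  · exact Primrec.option_bind (Nat.Partrec.Code.primrec_evaln.comp
      ((Primrec.fst.pair (Primrec.const c)).pair (Primrec.encode.comp Primrec.snd)))
      (Primrec.decode.comp Primrec.snd).to₂
  · intro k a b h
    obtain ⟨n, hn, hb⟩ := Option.bind_eq_some_iff.1 h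
    obtain ⟨b', hb', rfl⟩ := (hmem a n).1 (Nat.Partrec.Code.evaln_sound hn)
    rw [Encodable.encodek] at hb
    exact Option.some.inj hb ▸ hb'
  · intro a b hb
    obtain ⟨k₀, hk₀⟩ := Nat.Partrec.Code.evaln_complete.1 ((hmem a _).2 ⟨b, hb, rfl⟩)
    filter_upwards [Filter.eventually_ge_atTop k₀] with k hk
    exact Option.bind_eq_some_iff.2
      ⟨_, Nat.Partrec.Code.evaln_mono hk hk₀, Encodable.encodek b⟩

theorem CertEvalDecidable.exists_approximation {C : Set Ontology} (h : CertEvalDecidable C) :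
    ∃ F : ℕ → Input → Option Bool, Primrec₂ F ∧
      (∀ k w, IsInput C w → ∀ b, F k w = some b → (b = true ↔ Holds w)) ∧
      ∀ w, IsInput C w → ∀ᶠ k in Filter.atTop, ∃ b, F k w = some b ∧ (b = true ↔ Holds w) := by
  obtain ⟨f, hf, hfC⟩ := h
  obtain ⟨F, hF, hsound, hcomplete⟩ := exists_primrec_approximation hf
  refine ⟨F, hF, fun k w hw b hb => ?_, fun w hw => ?_⟩
  · obtain ⟨b', hb', hholds⟩ := hfC w hw
    rwa [Part.mem_unique (hsound k w b hb) hb']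
  · obtain ⟨b, hb, hholds⟩ := hfC w hw
    exact (hcomplete w b hb).mono fun k hk => ⟨b, hk, hholds⟩

/-- What `AuxStep` depends on: the shifted database, the domain, the main part, and the queries of
the auxiliary predicates. -/
abbrev SatInput := (Database × List ℕ) × Ontology × List (ℕ × CQ)

/-- The data for the search for a saturated list of auxiliary facts. -/
noncomputable def satInput (S : Ontology) (D : Database) : SatInput :=
  ((shiftAtoms S D, domain D S), mainPart S, auxQueries S)

/-- `AuxStep`, as far as the partial decision procedure `F` for cert-eval confirms it. -/
def ConfirmedStep (F : Input → Option Bool) (x : SatInput) (A : Database) (a : Fact) : Prop :=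
  ∃ e ∈ x.2.2, a.1 = e.1 ∧ a.2 ∈ tuples x.1.2 e.2.1.length ∧
    F (x.1.1 ++ A, x.2.1, e.2, a.2) = some true

/-- `IsSaturation`, as far as the partial decision procedure `F` for cert-eval confirms it. Facts
outside of `A` have to be refuted explicitly, since `F` may give no answer. -/
def ConfirmedSaturation (F : Input → Option Bool) (x : SatInput) (A : Database) : Prop :=
  IsDerivation (ConfirmedStep F x) A ∧ ∀ e ∈ x.2.2, ∀ t ∈ tuples x.1.2 e.2.1.length,
    (e.1, t) ∈ A ∨ F (x.1.1 ++ A, x.2.1, e.2, t) = some false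

section Confirmed

variable {C : Set Ontology} {S : Ontology} {D A : Database}

theorem isInput_auxQuery (hS : mainPart S ∈ C) {e : ℕ × CQ} (he : e ∈ auxQueries S)
    {U : List ℕ} {t : List ℕ} (ht : t ∈ tuples U e.2.1.length) (D : Database) :
    IsInput C (D, mainPart S, e.2, t) := by
  obtain ⟨k, σ, -, -, hq⟩ := mem_auxQueries.1 he
  exact ⟨hS, hq ▸ auxQuery_wellFormed S k σ, (mem_tuples.1 ht).1⟩

theorem ConfirmedSaturation.isSaturation {F : Input → Option Bool}
    (hA : ConfirmedSaturation F (satInput S D) A)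
    (hF : ∀ w, IsInput C w → ∀ b, F w = some b → (b = true ↔ Holds w)) (hS : mainPart S ∈ C) :
    IsSaturation (AuxStep S D) A := by
  refine ⟨hA.1.mono ?_, ?_⟩
  · rintro A a ⟨e, he, hn, ht, hFe⟩
    exact ⟨e.2, hn ▸ he, ht, (hF _ (isInput_auxQuery hS he ht _) _ hFe).1 rfl⟩
  · rintro ⟨n, t⟩ ⟨q, hq, ht, hc⟩
    refine (hA.2 (n, q) hq t ht).resolve_right fun h => ?_
    exact Bool.false_ne_true ((hF _ (isInput_auxQuery hS hq ht _) _ h).2 hc)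

variable {F : ℕ → Input → Option Bool}
  (hF : ∀ w, IsInput C w → ∀ᶠ k in Filter.atTop, ∃ b, F k w = some b ∧ (b = true ↔ Holds w))
include hF

theorem eventually_isDerivation_confirmedStep (hS : mainPart S ∈ C)
    (hA : IsDerivation (AuxStep S D) A) :
    ∀ᶠ k in Filter.atTop, IsDerivation (ConfirmedStep (F k) (satInput S D)) A := by
  induction hA with
  | nil => exact Filter.Eventually.of_forall fun _ => .nil
  | @cons a A ha _ ih =>
    obtain ⟨q, hq, ht, hc⟩ := ha
    filter_upwards [ih, hF _ (isInput_auxQuery hS hq ht (auxDatabase S D A))]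
    rintro k hA ⟨b, hb, hholds⟩
    rw [hholds.2 hc] at hb
    exact .cons ⟨_, hq, rfl, ht, hb⟩ hA

theorem exists_confirmedSaturation (hS : mainPart S ∈ C) (D : Database) :
    ∃ A k, ConfirmedSaturation (F k) (satInput S D) A := by
  obtain ⟨A, hA⟩ := exists_isSaturation_auxStep S D
  have hclosed : ∀ᶠ k in Filter.atTop, ∀ e ∈ auxQueries S,
      ∀ t ∈ tuples (domain D S) e.2.1.length,
        (e.1, t) ∈ A ∨ F k (auxDatabase S D A, mainPart S, e.2, t) = some false := by
    refine (Filter.eventually_all_finite (List.finite_toSet _)).2 fun e he =>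
      (Filter.eventually_all_finite (List.finite_toSet _)).2 fun t ht => ?_
    filter_upwards [hF _ (isInput_auxQuery hS he ht (auxDatabase S D A))]
    rintro k ⟨_ | _, hb, hholds⟩
    · exact Or.inr hb
    · exact Or.inl (hA.mem_of_step _ ⟨_, he, ht, hholds.1 rfl⟩)
  exact ⟨A, ((eventually_isDerivation_confirmedStep hF hS hA.isDerivation).and hclosed).exists⟩

end Confirmed

section Primrec

variable {α : Type*} [Primcodable α] {F : α → Input → Option Bool} {x : α → SatInput}
  {A : α → Database}

theorem primrecPred_confirmedStep {a : α → Fact} (hF : Primrec fun y : α × Input => F y.1 y.2)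
    (hx : Primrec x) (hA : Primrec A) (ha : Primrec a) :
    PrimrecPred fun b => ConfirmedStep (F b) (x b) (A b) (a b) := by
  have : Primrec fun y : α × ℕ × CQ =>
      F y.1 ((x y.1).1.1 ++ A y.1, (x y.1).2.1, y.2.2, (a y.1).2) :=
    hF.comp (g := fun y : α × ℕ × CQ =>
      (y.1, (x y.1).1.1 ++ A y.1, (x y.1).2.1, y.2.2, (a y.1).2)) (by fun_prop)
  unfold ConfirmedStep
  fun_prop

theorem primrecPred_confirmedSaturation (hF : Primrec fun y : α × Input => F y.1 y.2)
    (hx : Primrec x) (hA : Primrec A) :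
    PrimrecPred fun b => ConfirmedSaturation (F b) (x b) (A b) := by
  have hstep : PrimrecPred fun y : α × Database × Fact =>
      ConfirmedStep (F y.1) (x y.1) y.2.1 y.2.2 :=
    primrecPred_confirmedStep (F := fun y : α × Database × Fact => F y.1)
      (hF.comp (g := fun z : (α × Database × Fact) × Input => (z.1.1, z.2)) (by fun_prop))
      (by fun_prop) (by fun_prop) (by fun_prop)
  have : Primrec fun y : (α × ℕ × CQ) × List ℕ =>
      F y.1.1 ((x y.1.1).1.1 ++ A y.1.1, (x y.1.1).2.1, y.1.2.2, y.2) :=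
    hF.comp (g := fun y : (α × ℕ × CQ) × List ℕ =>
      (y.1.1, (x y.1.1).1.1 ++ A y.1.1, (x y.1.1).2.1, y.1.2.2, y.2)) (by fun_prop)
  refine (primrecPred_isDerivation hA hstep).and ?_
  fun_prop

@[fun_prop]
theorem primrec_shiftAtoms {β : Type} [Primcodable β] {S : α → Ontology}
    {A : α → List (AtomOver β)} (hS : Primrec S) (hA : Primrec A) :
    Primrec fun a => shiftAtoms (S a) (A a) := by
  unfold shiftAtoms shiftName
  fun_prop

@[fun_prop]
theorem primrec_domain {S : α → Ontology} (hA : Primrec A) (hS : Primrec S) :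
    Primrec fun a => domain (A a) (S a) := by
  unfold domain
  fun_prop

end Primrec

theorem computable_satInput : Computable fun w : Input => satInput w.2.1 w.1 := by
  have hdata : Primrec fun w : Input => (shiftAtoms w.2.1 w.1, domain w.1 w.2.1) := by fun_prop
  exact hdata.to_comp.pair (computable_mainPart_auxQueries.comp
    (Computable.fst.comp Computable.snd))

/-! ### Certain answers over the main part -/

/-- The input over `main(Σ)` that is equivalent to `w` if `A` is a saturated list of auxiliary
facts. -/
noncomputable def mainInput (w : Input) (A : Database) : Input :=
  (auxDatabase w.2.1 w.1 A, mainPart w.2.1, (w.2.2.1.1, shiftAtoms w.2.1 w.2.2.1.2), w.2.2.2)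

theorem conjVars_shiftAtoms (S : Ontology) (A : Conj) : conjVars (shiftAtoms S A) = conjVars A := by
  simp [conjVars, shiftAtoms, List.flatMap_map]

theorem IsInput.mainInput {C : Set Ontology} {w : Input} (hw : IsInput {S | mainPart S ∈ C} w)
    (A : Database) : IsInput C (mainInput w A) :=
  ⟨hw.1, fun x hx => (conjVars_shiftAtoms _ _).symm ▸ hw.2.1 x hx, hw.2.2⟩

theorem holds_mainInput_iff {w : Input} {A : Database}
    (hA : IsSaturation (AuxStep w.2.1 w.1) A) : Holds (mainInput w A) ↔ Holds w :=
  hA.cert_mainPart_iff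

theorem computable_mainPart : Computable mainPart :=
  Computable.fst.comp computable_mainPart_auxQueries

theorem computable₂_mainInput : Computable₂ mainInput := by
  have hdatabase : Primrec fun y : Input × Database => shiftAtoms y.1.2.1 y.1.1 ++ y.2 := by
    fun_prop
  have hquery : Primrec fun y : Input × Database =>
      ((y.1.2.2.1.1, shiftAtoms y.1.2.1 y.1.2.2.1.2), y.1.2.2.2) := by
    fun_prop
  exact hdatabase.to_comp.pair ((computable_mainPart.comp
    (Computable.fst.comp (Computable.snd.comp Computable.fst))).pair hquery.to_comp)

theorem CertEvalDecidable.mainPart {C : Set Ontology} (h : CertEvalDecidable C) :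
    CertEvalDecidable {S | mainPart S ∈ C} := by
  obtain ⟨F, hF, hsound, hcomplete⟩ := h.exists_approximation
  obtain ⟨f, hf, hfC⟩ := h
  have hconfirmed : PrimrecPred fun y : SatInput × Database × ℕ =>
      ConfirmedSaturation (F y.2.2) y.1 y.2.1 :=
    primrecPred_confirmedSaturation (F := fun y : SatInput × Database × ℕ => F y.2.2)
      (hF.comp (by fun_prop) (by fun_prop)) (by fun_prop) (by fun_prop)
  obtain ⟨s, hs, hsR, hdom⟩ := exists_partrec_search (α := SatInput) (β := Database × ℕ)
    (R := fun x y => ConfirmedSaturation (F y.2) x y.1) hconfirmed.computablePred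
  refine ⟨fun w => (s (satInput w.2.1 w.1)).bind fun y => f (mainInput w y.1),
    (hs.comp computable_satInput).bind (hf.comp (computable₂_mainInput.comp Computable.fst
      (Computable.fst.comp Computable.snd))), fun w hw => ?_⟩
  obtain ⟨A, k, hAk⟩ := exists_confirmedSaturation hcomplete hw.1 w.1
  obtain ⟨⟨A, k⟩, hAk⟩ := Part.dom_iff_mem.1 (hdom _ ⟨(A, k), hAk⟩)
  obtain ⟨b, hb, hholds⟩ := hfC _ (hw.mainInput A)
  have hA : IsSaturation (AuxStep w.2.1 w.1) A := (hsR _ _ hAk).isSaturation (hsound k) hw.1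
  exact ⟨b, Part.mem_bind hAk hb, hholds.trans (holds_mainInput_iff hA)⟩

/-! ### Dyadic classes -/

theorem CertEvalDecidable.dyadic {C : Set Ontology} (h : CertEvalDecidable C)
    (hs : CaseEffective C) : CertEvalDecidable (Dyadic C) := by
  obtain ⟨g, hg, hgC⟩ := h.mainPart
  obtain ⟨f, hf, hfC⟩ := h
  obtain ⟨s, hs, hsC⟩ := hs
  refine ⟨fun w => (s w.2.1).bind fun b => bif b then f w else g w,
    (hs.comp (Computable.fst.comp Computable.snd)).bind (Partrec.cond Computable.snd
      (hf.comp Computable.fst) (hg.comp Computable.fst)).to₂, fun w hw => ?_⟩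
  obtain ⟨b, hb, htrue, hfalse⟩ := hsC w.2.1 hw.1
  cases b with
  | true =>
    obtain ⟨b', hb', h⟩ := hfC w ⟨htrue rfl, hw.2⟩
    exact ⟨b', Part.mem_bind hb hb', h⟩
  | false =>
    obtain ⟨b', hb', h⟩ := hgC w ⟨hfalse rfl, hw.2⟩
    exact ⟨b', Part.mem_bind hb hb', h⟩

/-! ### Decidability as a set -/

section ComputablePred

variable {α β : Type*} [Primcodable α] [Primcodable β] {p q : α → Prop}

theorem computablePred_comp (hp : ComputablePred p) {f : β → α} (hf : Computable f) :
    ComputablePred fun b => p (f b) := by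
  classical
  exact (hp.decide.comp hf).computablePred

theorem computablePred_and (hp : ComputablePred p) (hq : ComputablePred q) :
    ComputablePred fun a => p a ∧ q a := by
  classical
  refine Computable.computablePred ((Primrec.and.to_comp.comp hp.decide hq.decide).of_eq ?_)
  simp

theorem computablePred_or (hp : ComputablePred p) (hq : ComputablePred q) :
    ComputablePred fun a => p a ∨ q a := by
  classical
  refine Computable.computablePred ((Primrec.or.to_comp.comp hp.decide hq.decide).of_eq ?_)
  simp

end ComputablePred

section DecidableSet

variable {C : Set Ontology}

theorem isInput_nil_and_holds_nil_iff {S : Ontology} :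
    (IsInput C ([], S, ([], []), []) ∧ Holds ([], S, ([], []), [])) ↔ S ∈ C :=
  ⟨fun h => h.1.1, fun h => ⟨⟨h, by simp [CQ.WellFormed], rfl⟩,
    fun _ _ => ⟨fun _ => Value.const 0, by simp [IsHom], rfl⟩⟩⟩

/-- The empty query has a certain answer, so a decision about it is one about membership in `C`. -/
theorem CertEvalDecidableSet.computablePred_mem (h : CertEvalDecidableSet C) :
    ComputablePred fun S => S ∈ C := by
  have hinput : Primrec fun S : Ontology => (([], S, ([], []), []) : Input) := by fun_prop
  exact (computablePred_comp h hinput.to_comp).of_eq fun _ => isInput_nil_and_holds_nil_iff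

theorem CertEvalDecidableSet.certEvalDecidable (h : CertEvalDecidableSet C) :
    CertEvalDecidable C := by
  obtain ⟨_, hC⟩ := h
  exact ⟨_, hC.partrec, fun w hw => ⟨_, Part.mem_some _, by simp [hw]⟩⟩

theorem caseEffective_of_computablePred_mem (h : ComputablePred fun S => S ∈ C) :
    CaseEffective C := by
  classical
  exact ⟨fun S => Part.some (decide (S ∈ C)), h.decide.partrec, fun S hS =>
    ⟨_, Part.mem_some _, by simp, fun h => hS.resolve_left (by simpa using h)⟩⟩

theorem computablePred_isInput (h : ComputablePred fun S => S ∈ C) :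
    ComputablePred (IsInput C) := by
  have hquery : PrimrecPred fun w : Input =>
      (∀ x ∈ w.2.2.1.1, x ∈ conjVars w.2.2.1.2) ∧ w.2.2.2.length = w.2.2.1.1.length := by
    fun_prop
  exact computablePred_and (computablePred_comp h (Computable.fst.comp Computable.snd))
    hquery.computablePred

theorem CertEvalDecidable.certEvalDecidableSet (h : CertEvalDecidable C)
    (hC : ComputablePred fun S => S ∈ C) : CertEvalDecidableSet C := by
  classical
  obtain ⟨f, hf, hfC⟩ := h
  refine Computable.computablePred (Partrec.of_eq_tot (Partrec.cond
    (computablePred_isInput hC).decide hf (Computable.const false).partrec) fun w => ?_)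
  by_cases hw : IsInput C w
  · obtain ⟨b, hb, hholds⟩ := hfC w hw
    have hdecide : decide (IsInput C w ∧ Holds w) = b := by
      rw [Bool.eq_iff_iff, ← hholds]
      simp [hw, hholds]
    rw [hdecide]
    simpa [hw] using hb
  · simp [hw]

theorem computablePred_mem_dyadic (h : ComputablePred fun S => S ∈ C) :
    ComputablePred fun S => S ∈ Dyadic C :=
  computablePred_or h (computablePred_comp h computable_mainPart)

theorem CertEvalDecidableSet.dyadic (h : CertEvalDecidableSet C) :
    CertEvalDecidableSet (Dyadic C) :=
  (h.certEvalDecidable.dyadic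
    (caseEffective_of_computablePred_mem h.computablePred_mem)).certEvalDecidableSet
      (computablePred_mem_dyadic h.computablePred_mem)

end DecidableSet

end DyadicTGD

theorem mainTheorem1 (C : Set DyadicTGD.Ontology) :
    (DyadicTGD.CertEvalDecidable C →
      DyadicTGD.CertEvalDecidable {S | DyadicTGD.mainPart S ∈ C} ∧
      (DyadicTGD.CaseEffective C → DyadicTGD.CertEvalDecidable (DyadicTGD.Dyadic C))) ∧
    (DyadicTGD.CertEvalDecidableSet C →
      DyadicTGD.CertEvalDecidableSet (DyadicTGD.Dyadic C)) :=
  ⟨fun h => ⟨h.mainPart, h.dyadic⟩, fun h => h.dyadic⟩
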